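/- Let $n \ge 1$ and let $X_1,\dots,X_n$ be any real numbers (a realization of the sample), with order statistics $X_{(1)} \le \dots \le X_{(n)}$ and empirical measure $\mu_n = \frac1n\sum_{i=1}^n \delta_{X_i}$. For probability measures $\pi_1,\pi_2$ on $\mathbb R$ let $$W_1(\pi_1,\pi_2)=\inf_{\pi\in\Pi(\pi_1,\pi_2)}\int_{\mathbb R\times\mathbb R}|x-y|\,d\pi(x,y)\in[0,\infty],$$ where $\Pi(\pi_1,\pi_2)$ is the set of probability measures on $\mathbb R\times\mathbb R$ with marginals $\pi_1,\pi_2$. For $K>0$ let $\mathrm{Lip}_K([0,1],\mathbb R)$ be the set of $K$-Lipschitz functions $G:[0,1]\to\mathbb R$, and write $G_{\sharp U}$ for the law of $G(U)$ with $U$ uniform on $[0,1]$. Let $K>0$ satisfy $K\ge n\,(X_{(i+1)}-X_{(i)})$ for all $1\le i\le n-1$. Define $\widehat G^\star_K:[0,1]\to\mathbb R$ by $\widehat G^\star_K\equiv X_{(1)}$ if $n=1$ and, if $n\ge2$, $$\widehat G^\star_K(u)=\begin{cases} X_{(1)} & \text{if } u\in\big[0,\frac1n-\frac{X_{(2)}-X_{(1)}}{2K}\big],\\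 X_{(i)}+K\Big(u-\big(\frac in-\frac{X_{(i+1)}-X_{(i)}}{2K}\big)\Big) & \text{if } u\in\big[\frac in-\frac{X_{(i+1)}-X_{(i)}}{2K},\frac in+\frac{X_{(i+1)}-X_{(i)}}{2K}\big],\ 1\le i\le n-1,\\ X_{(i+1)} & \text{if } u\in\big[\frac in+\frac{X_{(i+1)}-X_{(i)}}{2K},\frac{i+1}n-\frac{X_{(i+2)}-X_{(i+1)}}{2K}\big],\ 1\le i\le n-2,\\ X_{(n)} & \text{if } u\in\big[\frac{n-1}n+\frac{X_{(n)}-X_{(n-1)}}{2K},1\big]. \end{cases}$$ (The condition on $K$ makes this well defined.) Then $\widehat G^\star_K\in\mathrm{Lip}_K([0,1],\mathbb R)$ and $$W_1(\widehat G^\star_{K\sharp U},\mu_n)=\inf_{G\in\mathrm{Lip}_K([0,1],\mathbb R)}W_1(G_{\sharp U},\mu_n)=\frac1{4K}\sum_{i=1}^{n-1}(X_{(i+1)}-X_{(i)})^2 .$$ Moreover, the set of minimizers is $$\Big\{G\in\mathrm{Lip}_K([0,1],\mathbb R): W_1(G_{\sharp U},\mu_n)=\inf_{H\in\mathrm{Lip}_K([0,1],\mathbb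 R)}W_1(H_{\sharp U},\mu_n)\Big\}=\{\widehat G^\star_K,\ \widehat G^\star_K\circ S\},\qquad S(u)=1-u .$$ -/

import Mathlib

open MeasureTheory
open scoped ENNReal unitInterval

noncomputable section

namespace WGAN

/-- `Lip_K(E, E')`: the set of `K`-Lipschitz maps from `E` to `E'`. -/
def lip (E E' : Type*) [PseudoMetricSpace E] [PseudoMetricSpace E'] (K : ℝ) : Set (E → E') :=
  {G | ∀ x y, dist (G x) (G y) ≤ K * dist x y}

/-- `Π(π₁, π₂)`: the measures on `E × E` with marginals `π₁` and `π₂`. -/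
def couplings {E : Type*} [MeasurableSpace E] (π₁ π₂ : Measure E) : Set (Measure (E × E)) :=
  {π | π.map Prod.fst = π₁ ∧ π.map Prod.snd = π₂}

/-- The `1`-Wasserstein distance (possibly `∞`), as an infimum of transport costs over couplings. -/
def W1 {E : Type*} [PseudoEMetricSpace E] [MeasurableSpace E] (π₁ π₂ : Measure E) : ℝ≥0∞ :=
  ⨅ π ∈ couplings π₁ π₂, ∫⁻ z, edist z.1 z.2 ∂π

/-- The empirical measure `μ_n = (1/n) ∑ δ_{X_i}`. -/
def empirical {E : Type*} [MeasurableSpace E] {n : ℕ} (X : Fin n → E) : Measure E :=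
  (n : ℝ≥0∞)⁻¹ • ∑ i, Measure.dirac (X i)

/-- `G_{♯U}`: the law of `G(U)` for `U` uniform on `[0,1]`. -/
def law {E : Type*} [MeasurableSpace E] (G : I → E) : Measure E :=
  (volume : Measure I).map G

/-- The infimum of `W₁(G_{♯U}, μ_n)` over `G ∈ Lip_K([0,1], ℝ)`. -/
def optimalValue {n : ℕ} (X : Fin n → ℝ) (K : ℝ) : ℝ≥0∞ :=
  ⨅ G ∈ lip I ℝ K, W1 (law G) (empirical X)

/-- The set of minimizers of `W₁(G_{♯U}, μ_n)` over `G ∈ Lip_K([0,1], ℝ)`. -/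
def minimizers {n : ℕ} (X : Fin n → ℝ) (K : ℝ) : Set (I → ℝ) :=
  {G | G ∈ lip I ℝ K ∧ W1 (law G) (empirical X) = optimalValue X K}

/-- The order statistic `X_(i)`, for `1 ≤ i ≤ n` (the value `0` outside this range is never
used). -/
def orderStat {n : ℕ} (X : Fin n → ℝ) (i : ℕ) : ℝ :=
  if h : i - 1 < n then X (Tuple.sort X ⟨i - 1, h⟩) else 0

/-- The gap `X_(i+1) - X_(i)`, for `1 ≤ i ≤ n - 1`. -/
def gap {n : ℕ} (X : Fin n → ℝ) (i : ℕ) : ℝ :=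
  orderStat X (i + 1) - orderStat X i

/-- The left end `i/n - (X_(i+1) - X_(i)) / (2K)` of the `i`-th increasing piece. -/
def left {n : ℕ} (X : Fin n → ℝ) (K : ℝ) (i : ℕ) : ℝ :=
  (i : ℝ) / n - gap X i / (2 * K)

/-- The right end `i/n + (X_(i+1) - X_(i)) / (2K)` of the `i`-th increasing piece. -/
def right {n : ℕ} (X : Fin n → ℝ) (K : ℝ) (i : ℕ) : ℝ :=
  (i : ℝ) / n + gap X i / (2 * K)

/-- The piecewise linear map that uses only the first `m` increasing pieces and then stays at
`X_(m+1)`. -/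
def pieces {n : ℕ} (X : Fin n → ℝ) (K : ℝ) : ℕ → ℝ → ℝ
  | 0, _ => orderStat X 1
  | m + 1, u =>
      if u ≤ left X K (m + 1) then pieces X K m u
      else if u ≤ right X K (m + 1) then
        orderStat X (m + 1) + K * (u - left X K (m + 1))
      else orderStat X (m + 2)

/-- The explicit piecewise linear map `Ĝ*_K : [0,1] → ℝ`, with its `n - 1` increasing pieces (it
is the constant `X_(1)` if `n = 1`). The theorems `Gstar_first`, `Gstar_ramp`, `Gstar_flat` and
`Gstar_last` below give its values on the successive (closed) pieces. -/
def Gstar {n : ℕ} (X : Fin n → ℝ) (K : ℝ) (u : I) : ℝ :=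
  pieces X K (n - 1) u

section Values

theorem gap_nonneg {n : ℕ} (X : Fin n → ℝ) {i : ℕ} (hi : i + 1 ≤ n) : 0 ≤ gap X i := by
  have h1 : i + 1 - 1 < n := by omega
  have h2 : i - 1 < n := by omega
  have h := Tuple.monotone_sort X (a := ⟨i - 1, h2⟩) (b := ⟨i + 1 - 1, h1⟩)
    (Fin.mk_le_mk.2 (by omega))
  unfold gap orderStat
  rw [dif_pos h1, dif_pos h2]
  exact sub_nonneg.2 h

theorem left_le_right {n : ℕ} (X : Fin n → ℝ) {K : ℝ} (hK : 0 < K) {i : ℕ} (hi : i + 1 ≤ n) :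
    left X K i ≤ right X K i := by
  have h := div_nonneg (gap_nonneg X hi) (by positivity : (0 : ℝ) ≤ 2 * K)
  unfold left right
  linarith

theorem right_le_left {n : ℕ} (X : Fin n → ℝ) {K : ℝ} (hK : 0 < K)
    (hgap : ∀ i, 1 ≤ i → i ≤ n - 1 → n * gap X i ≤ K) {i : ℕ} (h1 : 1 ≤ i) (h2 : i + 2 ≤ n) :
    right X K i ≤ left X K (i + 1) := by
  have hn : (0 : ℝ) < n := by exact_mod_cast (by omega : 0 < n)
  have key : ∀ j, 1 ≤ j → j ≤ n - 1 → gap X j / (2 * K) ≤ 1 / (2 * n) := by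
    intro j hj hj'
    rw [div_le_div_iff₀ (by positivity) (by positivity)]
    have := hgap j hj hj'
    linarith
  have a := key i h1 (by omega)
  have b := key (i + 1) (by omega) (by omega)
  have e : ((i + 1 : ℕ) : ℝ) / n = (i : ℝ) / n + 1 / (2 * n) + 1 / (2 * n) := by
    push_cast
    field_simp
    ring
  unfold left right
  rw [e]
  linarith

theorem left_mono {n : ℕ} (X : Fin n → ℝ) {K : ℝ} (hK : 0 < K)
    (hgap : ∀ i, 1 ≤ i → i ≤ n - 1 → n * gap X i ≤ K) {i j : ℕ} (h1 : 1 ≤ i) (hij : i ≤ j)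
    (hj : j + 1 ≤ n) : left X K i ≤ left X K j := by
  induction j, hij using Nat.le_induction with
  | base => exact le_rfl
  | succ k hk ih =>
    exact (ih (by omega)).trans ((left_le_right X hK (by omega)).trans
      (right_le_left X hK hgap (by omega) (by omega)))

/-- Adding later increasing pieces does not change the values at earlier points. -/
theorem pieces_eq {n : ℕ} (X : Fin n → ℝ) {K : ℝ} (hK : 0 < K)
    (hgap : ∀ i, 1 ≤ i → i ≤ n - 1 → n * gap X i ≤ K) {m k : ℕ} (hmk : m ≤ k) (hk : k + 1 ≤ n)
    {u : ℝ} (hu : m + 2 ≤ n → u ≤ left X K (m + 1)) : pieces X K k u = pieces X K m u := by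
  induction k, hmk using Nat.le_induction with
  | base => rfl
  | succ k hk' ih =>
    rw [pieces, if_pos, ih (by omega)]
    exact (hu (by omega)).trans (left_mono X hK hgap (by omega) (by omega) (by omega))

theorem pieces_flat {n : ℕ} (X : Fin n → ℝ) {K : ℝ} (hK : 0 < K)
    (hgap : ∀ i, 1 ≤ i → i ≤ n - 1 → n * gap X i ≤ K) {m : ℕ} (hm : m + 1 ≤ n) {u : ℝ}
    (hu : 1 ≤ m → right X K m ≤ u) : pieces X K m u = orderStat X (m + 1) := by
  induction m with
  | zero => rfl
  | succ m ih =>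
    have hr := hu (by omega)
    have hlr := left_le_right X hK (i := m + 1) (by omega)
    have hdiff : K * (right X K (m + 1) - left X K (m + 1)) = gap X (m + 1) := by
      unfold right left
      field_simp
      ring
    have hg : gap X (m + 1) = orderStat X (m + 2) - orderStat X (m + 1) := rfl
    rw [pieces]
    split_ifs with h h'
    · have e : right X K (m + 1) = left X K (m + 1) := by linarith
      rw [e, sub_self, mul_zero] at hdiff
      rw [ih (by omega) (fun h1 =>
        (right_le_left X hK hgap h1 (by omega)).trans (hlr.trans hr))]
      show orderStat X (m + 1) = orderStat X (m + 2)
      linarith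
    · have e : u = right X K (m + 1) := le_antisymm h' hr
      rw [e, hdiff, hg]
      show _ = orderStat X (m + 2)
      ring
    · rfl

/-- `Ĝ*_K = X_(1)` on `[0, 1/n - (X_(2) - X_(1)) / (2K)]`. -/
theorem Gstar_first {n : ℕ} (X : Fin n → ℝ) {K : ℝ} (hK : 0 < K)
    (hgap : ∀ i, 1 ≤ i → i ≤ n - 1 → n * gap X i ≤ K) (hn : 2 ≤ n)
    (u : I) (hu : (u : ℝ) ≤ left X K 1) : Gstar X K u = orderStat X 1 := by
  rw [Gstar, pieces_eq X hK hgap (Nat.zero_le _) (by omega) (fun _ => hu), pieces]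

/-- `Ĝ*_K(u) = X_(i) + K (u - (i/n - (X_(i+1) - X_(i)) / (2K)))` on the `i`-th increasing piece,
for `1 ≤ i ≤ n - 1`. -/
theorem Gstar_ramp {n : ℕ} (X : Fin n → ℝ) {K : ℝ} (hK : 0 < K)
    (hgap : ∀ i, 1 ≤ i → i ≤ n - 1 → n * gap X i ≤ K) {i : ℕ} (h1 : 1 ≤ i) (h2 : i ≤ n - 1)
    (u : I) (hl : left X K i ≤ u) (hr : (u : ℝ) ≤ right X K i) :
    Gstar X K u = orderStat X i + K * (u - left X K i) := by
  obtain ⟨m, rfl⟩ : ∃ m, i = m + 1 := ⟨i - 1, by omega⟩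
  rw [Gstar, pieces_eq X hK hgap h2 (by omega)
    (fun _ => hr.trans (right_le_left X hK hgap (by omega) (by omega))), pieces]
  split_ifs with h
  · rw [le_antisymm h hl, sub_self, mul_zero, add_zero]
    exact pieces_flat X hK hgap (by omega)
      (fun h1 => right_le_left X hK hgap h1 (by omega))
  · rfl

/-- `Ĝ*_K = X_(i+1)` between the `i`-th and the `(i+1)`-th increasing pieces, for
`1 ≤ i ≤ n - 2`. -/
theorem Gstar_flat {n : ℕ} (X : Fin n → ℝ) {K : ℝ} (hK : 0 < K)
    (hgap : ∀ i, 1 ≤ i → i ≤ n - 1 → n * gap X i ≤ K) {i : ℕ} (_h1 : 1 ≤ i) (h2 : i + 2 ≤ n)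
    (u : I) (hl : right X K i ≤ u) (hr : (u : ℝ) ≤ left X K (i + 1)) :
    Gstar X K u = orderStat X (i + 1) := by
  rw [Gstar, pieces_eq X hK hgap (m := i) (by omega) (by omega) (fun _ => hr)]
  exact pieces_flat X hK hgap (by omega) (fun _ => hl)

/-- `Ĝ*_K = X_(n)` on `[(n-1)/n + (X_(n) - X_(n-1)) / (2K), 1]`. -/
theorem Gstar_last {n : ℕ} (X : Fin n → ℝ) {K : ℝ} (hK : 0 < K)
    (hgap : ∀ i, 1 ≤ i → i ≤ n - 1 → n * gap X i ≤ K) (hn : 1 ≤ n)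
    (u : I) (hl : right X K (n - 1) ≤ u) : Gstar X K u = orderStat X n := by
  rw [Gstar, pieces_flat X hK hgap (by omega) (fun _ => hl), Nat.sub_add_cancel hn]

end Values

end WGAN

end

/-!
Write `F_G` for the distribution function of `G(U)`, and call the intervals between consecutive
order statistics gaps.

*Lower bound.* Under any coupling, the probability that a level `t` separates the two points is at
least `|F_G(t) - F_n(t)|`, where `F_n` is the distribution function of the sample; integrating in
`t` gives `∫ |F_G - F_n| ≤ W₁` (`lintegral_cdf_sub_le_W1`). On the `i`-th gap `F_n` is the constant
`i / n`. A `K`-Lipschitz map needs time at least `(t - s) / K` to cross from `s` to `t`, so `F_G`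
has slope at least `1 / K` where it is neither `0` nor `1` (`cdf_law_expansive`); where it is `0` or `1`
it is at distance at least `1 / n ≥ gap / K` from `i / n`. In all cases
`|F_G(s) - i/n| + |F_G(t) - i/n| ≥ |t - s| / K` on the gap. Taking for `s` the reflection of `t` in
the midpoint and integrating bounds the cost of the gap below by `gap² / (4K)` (`le_lintegral_gap`).

*Attainment.* `Ĝ*_K` is a sum of ramps, and the quantile function of the sample is the sum of the
corresponding jumps. Evaluating both at the same `U` gives a coupling whose cost is at most the sum
of the costs of replacing one jump by one ramp, which is `gap² / (4K)` (`W1_law_Gstar_le`).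

*Uniqueness.* Equality in the lower bound makes `F_G` affine of slope `1 / K` on each gap, with the
value `i / n` at its midpoint, and equal to `F_n` outside the range of the sample
(`ae_cdf_eq_optimalCdf`). All minimizers therefore have the same law as `Ĝ*_K`. It follows that such
a `G` attains the extreme order statistics, while the time it spends outside the sample is
`(X_(n) - X_(1)) / K`, just what climbing from one extreme to the other at slope `K` takes. Hence
`G` is monotone or antitone (`lip.monotone_of_volume_le`), and a continuous monotone map is determined
by its law (`eq_or_eq_comp_symm_of_law_eq`).
-/

open ProbabilityTheory Set

namespace WGAN

/-! ### Lipschitz maps on the unit interval and their laws -/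

theorem lip.lipschitzWith {G : I → ℝ} {K : ℝ} (hK : 0 < K) (hG : G ∈ lip I ℝ K) :
    LipschitzWith ⟨K, hK.le⟩ G :=
  LipschitzWith.of_dist_le_mul hG

theorem lip.continuous {G : I → ℝ} {K : ℝ} (hK : 0 < K) (hG : G ∈ lip I ℝ K) : Continuous G :=
  (lip.lipschitzWith hK hG).continuous

theorem isProbabilityMeasure_law {G : I → ℝ} (hG : Measurable G) :
    IsProbabilityMeasure (law G) :=
  Measure.isProbabilityMeasure_map hG.aemeasurable

theorem law_comp_symm {G : I → ℝ} (hG : Measurable G) : law (G ∘ unitInterval.symm) = law G := by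
  unfold law
  rw [← Measure.map_map hG unitInterval.measurable_symm,
    unitInterval.measurePreserving_symm.map_eq]

theorem lip.comp_symm {G : I → ℝ} {K : ℝ} (hG : G ∈ lip I ℝ K) :
    G ∘ unitInterval.symm ∈ lip I ℝ K := by
  intro x y
  refine (hG _ _).trans_eq ?_
  congr 1
  rw [Subtype.dist_eq, Subtype.dist_eq, unitInterval.coe_symm_eq, unitInterval.coe_symm_eq,
    dist_sub_left]

theorem cdf_law {G : I → ℝ} (hG : Measurable G) (t : ℝ) :
    cdf (law G) t = volume.real {u : I | G u ≤ t} := by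
  have := isProbabilityMeasure_law hG
  rw [cdf_eq_real, law, map_measureReal_apply hG measurableSet_Iic]
  rfl

theorem volume_pos_of_isOpen {U : Set I} (hU : IsOpen U) (hne : U.Nonempty) :
    0 < volume U := by
  obtain ⟨V, hV, rfl⟩ := isOpen_induced_iff.1 hU
  obtain ⟨x, hx⟩ := hne
  have hx1 : (x : ℝ) ∈ closure (Ioo (0 : ℝ) 1) := by
    rw [closure_Ioo zero_ne_one]
    exact x.2
  have hV' : (V ∩ Ioo 0 1).Nonempty := mem_closure_iff.1 hx1 V hV hx
  refine ((hV.inter isOpen_Ioo).measure_pos volume hV').trans_le ?_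
  rw [unitInterval.volume_apply]
  refine measure_mono fun y hy => ⟨⟨y, hy.2.1.le, hy.2.2.le⟩, hy.1, rfl⟩

/-- A `K`-Lipschitz map expands Lebesgue measure at most by the factor `K`. -/
theorem lip.volume_image_le {G : I → ℝ} {K : ℝ} (hK : 0 < K) (hG : G ∈ lip I ℝ K) (s : Set I) :
    volume (G '' s) ≤ ENNReal.ofReal K * volume s := by
  have h := (lip.lipschitzWith hK hG).hausdorffMeasure_image_le zero_le_one s
  rw [unitInterval.volume_apply, ← hausdorffMeasure_real,
    (isometry_subtype_coe (s := I)).hausdorffMeasure_image (Or.inl zero_le_one)]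
  refine h.trans_eq ?_
  rw [ENNReal.rpow_one]
  rw [ENNReal.ofReal, Real.toNNReal_of_nonneg hK.le]
  rfl

theorem lip.volume_real_image_le {G : I → ℝ} {K : ℝ} (hK : 0 < K) (hG : G ∈ lip I ℝ K)
    (s : Set I) : volume.real (G '' s) ≤ K * volume.real s := by
  have h := ENNReal.toReal_mono (by finiteness) (lip.volume_image_le hK hG s)
  rwa [ENNReal.toReal_mul, ENNReal.toReal_ofReal hK.le] at h

/-! ### The Wasserstein distance and distribution functions -/

theorem edist_eq_lintegral (x y : ℝ) :
    edist x y = ∫⁻ t, ((Ico x y).indicator 1 t + (Ico y x).indicator 1 t) := by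
  rw [lintegral_add_left (measurable_one.indicator measurableSet_Ico),
    lintegral_indicator_one measurableSet_Ico, lintegral_indicator_one measurableSet_Ico,
    Real.volume_Ico, Real.volume_Ico, edist_dist, Real.dist_eq]
  rcases le_total x y with h | h
  · rw [ENNReal.ofReal_of_nonpos (p := x - y) (by linarith), add_zero, abs_sub_comm,
      abs_of_nonneg (sub_nonneg.2 h)]
  · rw [ENNReal.ofReal_of_nonpos (p := y - x) (by linarith), zero_add,
      abs_of_nonneg (sub_nonneg.2 h)]

theorem measurableSet_le_and_lt {α : Type*} [MeasurableSpace α] {f g h : α → ℝ}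
    (hf : Measurable f) (hg : Measurable g) (hh : Measurable h) :
    MeasurableSet {x | f x ≤ g x ∧ g x < h x} :=
  (measurableSet_le hf hg).inter (measurableSet_lt hg hh)

/-- The easy half of the formula `W₁(μ, ν) = ∫ |F_μ - F_ν|`: under a coupling of `μ` and `ν`, the
integral in `t` of the probability that `t` separates the two points is the transport cost. -/
theorem lintegral_cdf_sub_le_W1 (μ ν : Measure ℝ) [IsProbabilityMeasure μ]
    [IsProbabilityMeasure ν] :
    ∫⁻ t, ENNReal.ofReal |cdf μ t - cdf ν t| ≤ W1 μ ν := by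
  refine le_iInf₂ fun π hπ => ?_
  obtain ⟨h1, h2⟩ := hπ
  have hprob : IsProbabilityMeasure π := by
    constructor
    rw [← preimage_univ (f := Prod.fst), ← Measure.map_apply measurable_fst .univ, h1,
      measure_univ]
  have hmeas : Measurable (Function.uncurry fun (z : ℝ × ℝ) (t : ℝ) =>
      ((Ico z.1 z.2).indicator 1 t + (Ico z.2 z.1).indicator 1 t : ℝ≥0∞)) := by
    have m1 : MeasurableSet {p : (ℝ × ℝ) × ℝ | p.1.1 ≤ p.2 ∧ p.2 < p.1.2} :=
      measurableSet_le_and_lt (by fun_prop) (by fun_prop) (by fun_prop)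
    have m2 : MeasurableSet {p : (ℝ × ℝ) × ℝ | p.1.2 ≤ p.2 ∧ p.2 < p.1.1} :=
      measurableSet_le_and_lt (by fun_prop) (by fun_prop) (by fun_prop)
    exact (measurable_one.indicator m1).add (measurable_one.indicator m2)
  simp_rw [edist_eq_lintegral]
  rw [lintegral_lintegral_swap hmeas.aemeasurable]
  refine lintegral_mono fun t => ?_
  have e1 : cdf μ t = π.real {z | z.1 ≤ t} := by
    rw [cdf_eq_real, ← h1, map_measureReal_apply measurable_fst measurableSet_Iic]
    rfl
  have e2 : cdf ν t = π.real {z | z.2 ≤ t} := by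
    rw [cdf_eq_real, ← h2, map_measureReal_apply measurable_snd measurableSet_Iic]
    rfl
  have m1 : MeasurableSet {z : ℝ × ℝ | z.1 ≤ t ∧ t < z.2} :=
    measurableSet_le_and_lt (by fun_prop) (by fun_prop) (by fun_prop)
  have m2 : MeasurableSet {z : ℝ × ℝ | z.2 ≤ t ∧ t < z.1} :=
    measurableSet_le_and_lt (by fun_prop) (by fun_prop) (by fun_prop)
  have key : ∫⁻ z : ℝ × ℝ, ((Ico z.1 z.2).indicator 1 t + (Ico z.2 z.1).indicator 1 t) ∂π
      = π {z | z.1 ≤ t ∧ t < z.2} + π {z | z.2 ≤ t ∧ t < z.1} := by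
    rw [← lintegral_indicator_one m1, ← lintegral_indicator_one m2,
      ← lintegral_add_left (measurable_one.indicator m1)]
    rfl
  show _ ≤ ∫⁻ z : ℝ × ℝ, ((Ico z.1 z.2).indicator 1 t + (Ico z.2 z.1).indicator 1 t) ∂π
  rw [key, ← ofReal_measureReal, ← ofReal_measureReal,
    ← ENNReal.ofReal_add measureReal_nonneg measureReal_nonneg, e1, e2]
  refine ENNReal.ofReal_le_ofReal ?_
  have a1 : π.real {z | z.1 ≤ t} ≤ π.real {z | z.1 ≤ t ∧ t < z.2} + π.real {z | z.2 ≤ t} :=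
    (measureReal_mono fun z hz => (lt_or_ge t z.2).imp (fun h => ⟨hz, h⟩) id).trans
      (measureReal_union_le _ _)
  have a2 : π.real {z | z.2 ≤ t} ≤ π.real {z | z.2 ≤ t ∧ t < z.1} + π.real {z | z.1 ≤ t} :=
    (measureReal_mono fun z hz => (lt_or_ge t z.1).imp (fun h => ⟨hz, h⟩) id).trans
      (measureReal_union_le _ _)
  have b1 : 0 ≤ π.real {z | z.1 ≤ t ∧ t < z.2} := measureReal_nonneg
  have b2 : 0 ≤ π.real {z | z.2 ≤ t ∧ t < z.1} := measureReal_nonneg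
  rw [abs_le]
  constructor <;> linarith

theorem exists_mem_Ioo_of_ae {p : ℝ → Prop} (hp : ∀ᵐ t, p t) {a b : ℝ} (hab : a < b) :
    ∃ t ∈ Ioo a b, p t := by
  by_contra! h
  have h0 : volume (Ioo a b) = 0 := measure_mono_null (fun t ht => h t ht) hp
  rw [Real.volume_Ioo, ENNReal.ofReal_eq_zero] at h0
  linarith

theorem eq_of_cdf_ae_eq {μ ν : Measure ℝ} [IsProbabilityMeasure μ] [IsProbabilityMeasure ν]
    (h : ∀ᵐ t, cdf μ t = cdf ν t) : μ = ν := by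
  have aux : ∀ f g : StieltjesFunction ℝ, (∀ᵐ t, f t = g t) → ∀ x, f x ≤ g x := by
    intro f g hfg x
    rw [← g.iInf_Ioi_eq x]
    have : Nonempty (Ioi x) := ⟨⟨x + 1, by simp⟩⟩
    refine le_ciInf fun r => ?_
    obtain ⟨t, ht, e⟩ := exists_mem_Ioo_of_ae hfg r.2
    exact (f.mono ht.1.le).trans (e.le.trans (g.mono ht.2.le))
  refine Measure.eq_of_cdf μ ν (StieltjesFunction.ext fun x => le_antisymm (aux _ _ h x) ?_)
  exact aux _ _ (h.mono fun _ => Eq.symm) x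

/-! ### Rigidity of Lipschitz maps with a given law -/

theorem range_subset_of_law_eq {G H : I → ℝ} (hG : Continuous G) (hH : Continuous H)
    (h : law G = law H) : range H ⊆ range G := by
  rintro _ ⟨u, rfl⟩
  by_contra hu
  have hO : IsOpen (range G)ᶜ := (isCompact_range hG).isClosed.isOpen_compl
  have h1 : law H (range G)ᶜ = 0 := by
    rw [← h, law, Measure.map_apply hG.measurable hO.measurableSet]
    convert measure_empty (μ := (volume : Measure I))
    ext v
    simp
  rw [law, Measure.map_apply hH.measurable hO.measurableSet] at h1
  exact (volume_pos_of_isOpen (hO.preimage hH) ⟨u, hu⟩).ne' h1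

/-- A continuous monotone map is the quantile function of its law. -/
theorem eq_of_monotone_of_law_eq {G H : I → ℝ} (hG : Continuous G) (hH : Continuous H)
    (mG : Monotone G) (mH : Monotone H) (h : law G = law H) : G = H := by
  have aux : ∀ G H : I → ℝ, Continuous G → Continuous H → Monotone G → Monotone H →
      law G = law H → ∀ u, H u ≤ G u := by
    intro G H hG hH mG mH h u
    by_contra! hlt
    obtain ⟨t, ht1, ht2⟩ := exists_between hlt
    have hO : IsOpen ({v | G v < t} ∩ {v | t < H v}) :=
      (isOpen_lt hG continuous_const).inter (isOpen_lt continuous_const hH)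
    have hpos := volume_pos_of_isOpen hO ⟨u, ht1, ht2⟩
    -- `{G ≤ t}` contains the disjoint sets `{H ≤ t}` and `{G < t < H}`, yet has the measure of
    -- the first one.
    have hsub : {v | H v ≤ t} ∪ ({v | G v < t} ∩ {v | t < H v}) ⊆ {v | G v ≤ t} := by
      rintro v (hv | hv)
      · have hvu : v ≤ u := by
          by_contra! huv
          exact absurd (mH huv.le) (not_le.2 (lt_of_le_of_lt hv ht2))
        exact (mG hvu).trans ht1.le
      · exact le_of_lt (show G v < t from hv.1)
    have hm := measureReal_mono (μ := (volume : Measure I)) hsub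
    have hd : Disjoint {v | H v ≤ t} ({v | G v < t} ∩ {v | t < H v}) :=
      disjoint_left.2 fun v (hv : H v ≤ t) hv' => not_lt.2 hv hv'.2
    rw [measureReal_union hd hO.measurableSet,
      ← cdf_law hG.measurable, ← cdf_law hH.measurable, h] at hm
    have : 0 < volume.real ({v | G v < t} ∩ {v | t < H v}) :=
      ENNReal.toReal_pos hpos.ne' (by finiteness)
    linarith
  exact funext fun u => le_antisymm (aux H G hH hG mH mG h.symm u) (aux G H hG hH mG mH h u)

/-- Away from a finite set `S` of values, the map `G` oscillates on an interval at most `K` times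
the length of time it spends outside `S`. -/
theorem lip.abs_sub_le {G : I → ℝ} {K : ℝ} (hK : 0 < K) (hG : G ∈ lip I ℝ K) {S : Set ℝ}
    (hS : S.Finite) {u v : I} (huv : u ≤ v) :
    |G v - G u| ≤ K * volume.real ({w | G w ∉ S} ∩ Ioc u v) := by
  refine le_trans ?_ (lip.volume_real_image_le hK hG _)
  have hsub : uIcc (G u) (G v) ⊆ G '' ({w | G w ∉ S} ∩ Ioc u v) ∪ (insert (G u) S) := by
    intro x hx
    obtain ⟨w, hw, rfl⟩ := intermediate_value_uIcc (lip.continuous hK hG).continuousOn hx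
    rw [uIcc_of_le huv] at hw
    by_cases hwS : G w ∈ S
    · exact Or.inr (Or.inr hwS)
    rcases hw.1.eq_or_lt with rfl | hlt
    · exact Or.inr (Or.inl rfl)
    · exact Or.inl ⟨w, ⟨hwS, hlt, hw.2⟩, rfl⟩
  have h0 : volume (insert (G u) S) = 0 := (hS.insert _).measure_zero _
  have hfin : volume (G '' ({w | G w ∉ S} ∩ Ioc u v)) ≠ ∞ :=
    ((lip.volume_image_le hK hG _).trans_lt (by finiteness)).ne
  have h1 : volume (uIcc (G u) (G v)) ≤ volume (G '' ({w | G w ∉ S} ∩ Ioc u v)) :=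
    (measure_mono hsub).trans ((measure_union_le _ _).trans_eq (by rw [h0, add_zero]))
  rw [Real.volume_interval] at h1
  have h2 := ENNReal.toReal_mono hfin h1
  rwa [ENNReal.toReal_ofReal (abs_nonneg _)] at h2

/-- If the time spent outside the finite set `S` is just sufficient to climb from `G u₀` to `G u₁`
at slope `K`, then `G` never descends. -/
theorem lip.monotone_of_volume_le {G : I → ℝ} {K : ℝ} (hK : 0 < K) (hG : G ∈ lip I ℝ K)
    {S : Set ℝ} (hS : S.Finite) {u₀ u₁ : I} (h01 : u₀ ≤ u₁)
    (hvol : K * volume.real {w | G w ∉ S} ≤ G u₁ - G u₀) : Monotone G := by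
  have hT : MeasurableSet {w | G w ∉ S} :=
    (lip.continuous hK hG).measurable hS.measurableSet.compl
  set φ : I → ℝ := fun u => K * volume.real ({w | G w ∉ S} ∩ Iic u) with hφ
  have hinc : ∀ {u v}, u ≤ v → |G v - G u| ≤ φ v - φ u := by
    intro u v huv
    refine (lip.abs_sub_le hK hG hS huv).trans_eq ?_
    have e : {w | G w ∉ S} ∩ Iic v
        = ({w | G w ∉ S} ∩ Iic u) ∪ ({w | G w ∉ S} ∩ Ioc u v) := by
      rw [← inter_union_distrib_left, Iic_union_Ioc_eq_Iic huv]
    have hd : Disjoint ({w | G w ∉ S} ∩ Iic u) ({w | G w ∉ S} ∩ Ioc u v) :=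
      disjoint_left.2 fun w hw hw' => not_lt.2 hw.2 hw'.2.1
    simp only [hφ]
    rw [e, measureReal_union hd (hT.inter measurableSet_Ioc)]
    ring
  have hφ0 : ∀ u, 0 ≤ φ u := fun u => by positivity
  have hφ1 : ∀ u, φ u ≤ G u₁ - G u₀ := fun u =>
    (mul_le_mul_of_nonneg_left (measureReal_mono inter_subset_left) hK.le).trans hvol
  have hφm : Monotone φ := fun u v huv => by
    have := (abs_nonneg _).trans (hinc huv)
    linarith
  intro u v huv
  have a1 := abs_le.1 (hinc huv)
  have b0 := hφ0 u₀
  have b1 := hφ1 u₁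
  have c01 := (le_abs_self _).trans (hinc h01)
  -- Outside `[u₀, u₁]` the map is constant, since `φ` is; inside, the increments add up.
  have key : ∀ w, G w = G u₀ + φ w := by
    intro w
    rcases le_total w u₀ with h | h
    · have a := abs_le.1 (hinc h)
      have := hφ0 w
      linarith [hφm h]
    rcases le_total w u₁ with h' | h'
    · have a := abs_le.1 (hinc h)
      have a' := abs_le.1 (hinc h')
      linarith
    · have a := abs_le.1 (hinc h')
      have := hφ1 w
      linarith [hφm h']
  rw [key u, key v]
  linarith [hφm huv]

/-- If `H` is monotone and climbs at slope `K` whenever its value is outside a finite set, then the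
only `K`-Lipschitz maps with the law of `H` are `H` and its reflection. -/
theorem eq_or_eq_comp_symm_of_law_eq {G H : I → ℝ} {K : ℝ} (hK : 0 < K) (hG : G ∈ lip I ℝ K)
    (hH : H ∈ lip I ℝ K) (mH : Monotone H) {S : Set ℝ} (hS : S.Finite)
    (hvol : K * volume.real {w | H w ∉ S} ≤ H 1 - H 0) (h : law G = law H) :
    G = H ∨ G = H ∘ unitInterval.symm := by
  have aux : ∀ G ∈ lip I ℝ K, law G = law H → ∀ u₀ u₁, u₀ ≤ u₁ → G u₀ = H 0 → G u₁ = H 1 →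
      G = H := by
    intro G hG h u₀ u₁ h01 e0 e1
    have cG := lip.continuous hK hG
    have cH := lip.continuous hK hH
    refine eq_of_monotone_of_law_eq cG cH ?_ mH h
    refine lip.monotone_of_volume_le hK hG hS h01 ?_
    rw [e0, e1]
    have e : volume.real {w | G w ∉ S} = volume.real {w | H w ∉ S} := by
      have := congrArg (fun μ : Measure ℝ => μ.real Sᶜ) h
      simp only [law] at this
      rwa [map_measureReal_apply cG.measurable hS.measurableSet.compl,
        map_measureReal_apply cH.measurable hS.measurableSet.compl] at this
    rwa [e]
  have hr := range_subset_of_law_eq (lip.continuous hK hG) (lip.continuous hK hH) h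
  obtain ⟨u₀, e0⟩ := hr ⟨0, rfl⟩
  obtain ⟨u₁, e1⟩ := hr ⟨1, rfl⟩
  rcases le_total u₀ u₁ with h01 | h01
  · exact Or.inl (aux G hG h u₀ u₁ h01 e0 e1)
  · right
    have := aux (G ∘ unitInterval.symm) (lip.comp_symm hG)
      ((law_comp_symm (lip.continuous hK hG).measurable).trans h)
      (unitInterval.symm u₀) (unitInterval.symm u₁) (unitInterval.strictAnti_symm.antitone h01)
      (by simpa using e0) (by simpa using e1)
    rw [← this]
    ext u
    simp

/-! ### The distribution function of a Lipschitz map across a gap -/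

/-- The distribution function of a `K`-Lipschitz map has slope at least `1 / K` wherever it is
neither `0` nor `1`, because crossing from `s` to `t` takes time `(t - s) / K`. -/
theorem cdf_law_expansive {G : I → ℝ} {K : ℝ} (hK : 0 < K) (hG : G ∈ lip I ℝ K) {s t : ℝ}
    (hst : s < t) :
    (t - s) / K ≤ cdf (law G) t - cdf (law G) s ∨ cdf (law G) s = 0 ∨ cdf (law G) t = 1 := by
  have cG := lip.continuous hK hG
  simp only [cdf_law cG.measurable]
  by_cases h1 : ∃ u, G u ≤ s
  swap
  · push Not at h1
    have : {u | G u ≤ s} = ∅ := by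
      ext u
      simpa using h1 u
    simp [this]
  by_cases h2 : ∃ u, t ≤ G u
  swap
  · push Not at h2
    have : {u | G u ≤ t} = univ := by
      ext u
      simpa using (h2 u).le
    simp [this]
  left
  obtain ⟨u, hu⟩ := h1
  obtain ⟨v, hv⟩ := h2
  have hsub : Ioc s t ⊆ G '' {w | s < G w ∧ G w ≤ t} := by
    intro x hx
    obtain ⟨w, rfl⟩ := mem_range_of_exists_le_of_exists_ge cG ⟨u, hu.trans hx.1.le⟩
      ⟨v, hx.2.trans hv⟩
    exact ⟨w, hx, rfl⟩
  have hfin : volume (G '' {w | s < G w ∧ G w ≤ t}) ≠ ∞ :=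
    ((lip.volume_image_le hK hG _).trans_lt (by finiteness)).ne
  have h3 := (measureReal_mono hsub hfin).trans (lip.volume_real_image_le hK hG _)
  rw [Real.volume_real_Ioc_of_le hst.le] at h3
  have e : {w | G w ≤ t} = {w | G w ≤ s} ∪ {w | s < G w ∧ G w ≤ t} := by
    ext w
    simp only [mem_ofPred_eq, mem_union]
    constructor
    · intro h
      exact (le_or_gt (G w) s).imp id fun h' => ⟨h', h⟩
    · rintro (h | h)
      · exact h.trans hst.le
      · exact h.2
  have hm : MeasurableSet {w | s < G w ∧ G w ≤ t} := cG.measurable measurableSet_Ioc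
  have hd : Disjoint {w | G w ≤ s} {w | s < G w ∧ G w ≤ t} :=
    disjoint_left.2 fun w (hw : G w ≤ s) hw' => not_lt.2 hw hw'.1
  rw [e, measureReal_union hd hm, div_le_iff₀ hK]
  linarith

theorem integral_abs_sub_midpoint {a b : ℝ} (hab : a ≤ b) :
    ∫ t in a..b, |a + b - 2 * t| = (b - a) ^ 2 / 2 := by
  have i1 : ∀ x y : ℝ, IntervalIntegrable (fun t : ℝ => |a + b - 2 * t|) volume x y := fun x y =>
    Continuous.intervalIntegrable (by fun_prop) _ _
  rw [← intervalIntegral.integral_add_adjacent_intervals (i1 a ((a + b) / 2)) (i1 _ b)]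
  have e1 : ∫ t in a..((a + b) / 2), |a + b - 2 * t| = ∫ t in a..((a + b) / 2), (a + b - 2 * t) :=
    intervalIntegral.integral_congr fun t ht => by
      rw [uIcc_of_le (by linarith)] at ht
      exact abs_of_nonneg (by linarith [ht.2])
  have e2 : ∫ t in ((a + b) / 2)..b, |a + b - 2 * t| = ∫ t in ((a + b) / 2)..b, (2 * t - (a + b)) :=
    intervalIntegral.integral_congr fun t ht => by
      rw [uIcc_of_le (by linarith)] at ht
      exact (abs_of_nonpos (by linarith [ht.1])).trans (by ring)
  rw [e1, e2,
    intervalIntegral.integral_sub (by simp) (Continuous.intervalIntegrable (by fun_prop) _ _),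
    intervalIntegral.integral_sub (Continuous.intervalIntegrable (by fun_prop) _ _) (by simp)]
  have e3 : ∀ x y : ℝ, ∫ t in x..y, 2 * t = y ^ 2 - x ^ 2 := fun x y => by
    rw [intervalIntegral.integral_const_mul, integral_id]
    ring
  rw [e3, e3]
  simp only [intervalIntegral.integral_const, smul_eq_mul]
  ring

theorem lintegral_Ioo_eq_ofReal_integral {f : ℝ → ℝ} (hf : Continuous f) {a b : ℝ} (hab : a ≤ b)
    (h0 : ∀ t ∈ Ioo a b, 0 ≤ f t) :
    ∫⁻ t in Ioo a b, ENNReal.ofReal (f t) = ENNReal.ofReal (∫ t in a..b, f t) := by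
  rw [intervalIntegral.integral_of_le hab, integral_Ioc_eq_integral_Ioo,
    ofReal_integral_eq_lintegral_ofReal]
  · exact (hf.integrableOn_Icc).mono_set Ioo_subset_Icc_self
  · exact (ae_restrict_iff' measurableSet_Ioo).2 (.of_forall h0)

theorem lintegral_Ioo_reflect (f : ℝ → ℝ≥0∞) (hf : Measurable f) (a b : ℝ) :
    ∫⁻ t in Ioo a b, f (a + b - t) = ∫⁻ t in Ioo a b, f t := by
  have h := (Measure.measurePreserving_sub_left volume (a + b)).setLIntegral_comp_preimage
    (s := Ioo a b) measurableSet_Ioo hf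
  rw [preimage_const_sub_Ioo] at h
  simpa using h

section Gap

variable {h : ℝ → ℝ} {a b K : ℝ}

theorem le_abs_add_abs_reflect
    (hexp : ∀ s ∈ Ioo a b, ∀ t ∈ Ioo a b, s < t → (t - s) / K ≤ |h s| + |h t|) {t : ℝ}
    (ht : t ∈ Ioo a b) : |a + b - 2 * t| / K ≤ |h t| + |h (a + b - t)| := by
  have ht' : a + b - t ∈ Ioo a b := ⟨by linarith [ht.2], by linarith [ht.1]⟩
  rcases lt_trichotomy t (a + b - t) with hlt | heq | hlt
  · rw [abs_of_nonneg (by linarith)]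
    exact le_trans (le_of_eq (by ring)) (hexp t ht _ ht' hlt)
  · rw [show a + b - 2 * t = 0 by linarith, abs_zero, zero_div]
    positivity
  · rw [abs_of_nonpos (by linarith), add_comm |h t|]
    exact le_trans (le_of_eq (by ring)) (hexp _ ht' t ht hlt)

theorem lintegral_midpoint (hK : 0 < K) (hab : a ≤ b) :
    ∫⁻ t in Ioo a b, ENNReal.ofReal (|a + b - 2 * t| / K)
      = 2 * ENNReal.ofReal ((b - a) ^ 2 / (4 * K)) := by
  rw [lintegral_Ioo_eq_ofReal_integral (by fun_prop) hab
      (fun t _ => div_nonneg (abs_nonneg _) hK.le),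
    intervalIntegral.integral_div, integral_abs_sub_midpoint hab,
    ← ENNReal.ofReal_ofNat, ← ENNReal.ofReal_mul (by norm_num)]
  congr 1
  ring

theorem two_mul_lintegral_gap (hm : Measurable h) :
    2 * ∫⁻ t in Ioo a b, ENNReal.ofReal |h t|
      = ∫⁻ t in Ioo a b, ENNReal.ofReal (|h t| + |h (a + b - t)|) := by
  simp_rw [ENNReal.ofReal_add (abs_nonneg _) (abs_nonneg _)]
  rw [lintegral_add_left (by fun_prop),
    lintegral_Ioo_reflect (fun t => ENNReal.ofReal |h t|) (by fun_prop), two_mul]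

/-- Averaging over the reflection `t ↦ a + b - t` of the gap bounds the cost below. -/
theorem le_lintegral_gap (hK : 0 < K) (hab : a ≤ b) (hm : Measurable h)
    (hexp : ∀ s ∈ Ioo a b, ∀ t ∈ Ioo a b, s < t → (t - s) / K ≤ |h s| + |h t|) :
    ENNReal.ofReal ((b - a) ^ 2 / (4 * K)) ≤ ∫⁻ t in Ioo a b, ENNReal.ofReal |h t| := by
  rw [← ENNReal.mul_le_mul_iff_right two_ne_zero ENNReal.ofNat_ne_top, two_mul_lintegral_gap hm,
    ← lintegral_midpoint hK hab]
  exact setLIntegral_mono' measurableSet_Ioo fun t ht =>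
    ENNReal.ofReal_le_ofReal (le_abs_add_abs_reflect hexp ht)

theorem ae_abs_add_abs_reflect_eq (hK : 0 < K) (hab : a ≤ b) (hm : Measurable h)
    (hexp : ∀ s ∈ Ioo a b, ∀ t ∈ Ioo a b, s < t → (t - s) / K ≤ |h s| + |h t|)
    (hint : ∫⁻ t in Ioo a b, ENNReal.ofReal |h t| ≤ ENNReal.ofReal ((b - a) ^ 2 / (4 * K))) :
    ∀ᵐ t, t ∈ Ioo a b → |h t| + |h (a + b - t)| = |a + b - 2 * t| / K := by
  have hle := mul_le_mul_right hint 2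
  rw [two_mul_lintegral_gap hm, ← lintegral_midpoint hK hab] at hle
  have hae := ae_eq_of_ae_le_of_lintegral_le (μ := volume.restrict (Ioo a b))
    (f := fun t => ENNReal.ofReal (|a + b - 2 * t| / K))
    (g := fun t => ENNReal.ofReal (|h t| + |h (a + b - t)|))
    ((ae_restrict_iff' measurableSet_Ioo).2 (.of_forall fun t ht =>
      ENNReal.ofReal_le_ofReal (le_abs_add_abs_reflect hexp ht)))
    (by rw [lintegral_midpoint hK hab]; finiteness) (by fun_prop) hle
  rw [Filter.EventuallyEq, ae_restrict_iff' measurableSet_Ioo] at hae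
  filter_upwards [hae] with t ht htab
  exact ((ENNReal.ofReal_eq_ofReal_iff (by positivity) (by positivity)).1 (ht htab)).symm

variable {F : ℝ → ℝ} {p : ℝ}

theorem abs_add_abs_of_expansive
    (hF : ∀ s t, s < t → (t - s) / K ≤ F t - F s ∨ F s = 0 ∨ F t = 1)
    (hK : 0 < K) (hp : (b - a) / K ≤ p) (hp' : (b - a) / K ≤ 1 - p) :
    ∀ s ∈ Ioo a b, ∀ t ∈ Ioo a b, s < t → (t - s) / K ≤ |F s - p| + |F t - p| := by
  intro s hs t ht hst
  have hlt : (t - s) / K ≤ (b - a) / K :=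
    div_le_div_of_nonneg_right (by linarith [hs.1, ht.2]) hK.le
  have h1 := neg_abs_le (F s - p)
  have h2 := le_abs_self (F t - p)
  have h3 := abs_nonneg (F s - p)
  have h4 := abs_nonneg (F t - p)
  rcases hF s t hst with h | h | h
  · linarith
  · rw [h] at h1 ⊢
    linarith
  · rw [h] at h2 ⊢
    linarith

/-- In the case of equality the distribution function is affine of slope `1 / K` on the gap, and
takes the value `p` at its midpoint. -/
theorem ae_eq_affine_of_lintegral_gap_le (hm : Measurable F)
    (hF : ∀ s t, s < t → (t - s) / K ≤ F t - F s ∨ F s = 0 ∨ F t = 1)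
    (hK : 0 < K) (hab : a ≤ b) (hp : (b - a) / K ≤ p) (hp' : (b - a) / K ≤ 1 - p)
    (hint : ∫⁻ t in Ioo a b, ENNReal.ofReal |F t - p| ≤ ENNReal.ofReal ((b - a) ^ 2 / (4 * K))) :
    ∀ᵐ t, t ∈ Ioo a b → F t = p + (t - (a + b) / 2) / K := by
  have hae := ae_abs_add_abs_reflect_eq (h := fun t => F t - p) hK hab (by fun_prop)
    (abs_add_abs_of_expansive hF hK hp hp') hint
  set good : ℝ → Prop := fun t =>
    t ∈ Ioo a b → |F t - p| + |F (a + b - t) - p| = |a + b - 2 * t| / K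
  -- At a point of equality in the left half, the triangle inequality is tight across the midpoint.
  have claim : ∀ t, a < t → t < (a + b) / 2 → good t → F t ≤ p ∧ p ≤ F (a + b - t) ∧
      F (a + b - t) - F t = (a + b - 2 * t) / K ∧ F t ≠ 0 ∧ F (a + b - t) ≠ 1 := by
    intro t h1 h2 hg
    have e := hg ⟨h1, by linarith⟩
    rw [abs_of_nonneg (show 0 ≤ a + b - 2 * t by linarith)] at e
    have hlt : (a + b - 2 * t) / K < (b - a) / K := div_lt_div_of_pos_right (by linarith) hK
    have a1 := neg_abs_le (F t - p)
    have a2 := le_abs_self (F (a + b - t) - p)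
    have a3 := abs_nonneg (F t - p)
    have a4 := abs_nonneg (F (a + b - t) - p)
    have n0 : F t ≠ 0 := fun h0 => by
      rw [h0] at a1 e
      linarith
    have n1 : F (a + b - t) ≠ 1 := fun h0 => by
      rw [h0] at a2 e
      linarith
    have hx : (a + b - t - t) / K ≤ F (a + b - t) - F t := by
      rcases hF t (a + b - t) (by linarith) with h | h | h
      · exact h
      · exact absurd h n0
      · exact absurd h n1
    rw [show a + b - t - t = a + b - 2 * t by ring] at hx
    refine ⟨?_, ?_, by linarith, n0, n1⟩
    · have := abs_nonneg (F t - p)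
      have e1 : |F t - p| = -(F t - p) := by linarith
      linarith
    · have e1 : |F (a + b - t) - p| = F (a + b - t) - p := by linarith
      linarith
  have hpos : ∀ t, a < t → t < b → 0 < (b - a) / K := fun t h1 h2 => div_pos (by linarith) hK
  -- Points of equality accumulate at the midpoint; the slope bound between `t` and such a point
  -- `s`, where `F s ≤ p`, gives `F t ≤ p + (t - s) / K` in the limit. The right half is symmetric.
  have hleft : ∀ t, a < t → t < (a + b) / 2 → good t → F t ≤ p + (t - (a + b) / 2) / K := by
    intro t h1 h2 hg
    by_contra! hcon
    have hcon' : t + K * (p - F t) < (a + b) / 2 := by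
      have : t - (a + b) / 2 < (F t - p) * K := by
        rw [← div_lt_iff₀ hK]
        linarith
      linarith
    obtain ⟨s, hs, hgs⟩ := exists_mem_Ioo_of_ae hae (max_lt h2 hcon')
    obtain ⟨hs1, hs2⟩ := max_lt_iff.1 hs.1
    obtain ⟨b1, -, -, b4, -⟩ := claim t h1 h2 hg
    obtain ⟨c1, -, -, -, -⟩ := claim s (h1.trans hs1) hs.2 hgs
    rcases hF t s hs1 with h | h | h
    · rw [div_le_iff₀ hK] at h
      have : (F s - F t) * K ≤ (p - F t) * K := mul_le_mul_of_nonneg_right (by linarith) hK.le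
      linarith
    · exact b4 h
    · have := hpos t h1 (by linarith)
      linarith
  have hright : ∀ t, a < t → t < (a + b) / 2 → good t →
      p + (a + b - t - (a + b) / 2) / K ≤ F (a + b - t) := by
    intro t h1 h2 hg
    by_contra! hcon
    have hcon' : t + K * (F (a + b - t) - p) < (a + b) / 2 := by
      have : (F (a + b - t) - p) * K < a + b - t - (a + b) / 2 := by
        rw [← lt_div_iff₀ hK]
        linarith
      linarith
    obtain ⟨s, hs, hgs⟩ := exists_mem_Ioo_of_ae hae (max_lt h2 hcon')
    obtain ⟨hs1, hs2⟩ := max_lt_iff.1 hs.1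
    obtain ⟨-, -, -, -, b5⟩ := claim t h1 h2 hg
    obtain ⟨-, c2, -, -, -⟩ := claim s (h1.trans hs1) hs.2 hgs
    rcases hF (a + b - s) (a + b - t) (by linarith) with h | h | h
    · rw [div_le_iff₀ hK] at h
      have : (F (a + b - t) - F (a + b - s)) * K ≤ (F (a + b - t) - p) * K :=
        mul_le_mul_of_nonneg_right (by linarith) hK.le
      linarith
    · have := hpos t h1 (by linarith)
      linarith
    · exact b5 h
  have hboth : ∀ t, a < t → t < (a + b) / 2 → good t → F t = p + (t - (a + b) / 2) / K ∧
      F (a + b - t) = p + (a + b - t - (a + b) / 2) / K := by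
    intro t h1 h2 hg
    have l := hleft t h1 h2 hg
    have r := hright t h1 h2 hg
    have e := (claim t h1 h2 hg).2.2.1
    have e' : (a + b - 2 * t) / K
        = (a + b - t - (a + b) / 2) / K - (t - (a + b) / 2) / K := by ring
    constructor <;> linarith
  filter_upwards [hae] with t hg ht
  rcases lt_trichotomy t ((a + b) / 2) with hlt | heq | hlt
  · exact (hboth t ht.1 hlt hg).1
  · have e := hg ht
    rw [show a + b - t = t by linarith, show a + b - 2 * t = 0 by linarith, abs_zero, zero_div] at e
    have : F t - p = 0 := abs_eq_zero.1 (by linarith [abs_nonneg (F t - p)])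
    rw [heq, sub_self, zero_div, ← heq]
    linarith
  · have hg' : good (a + b - t) := fun _ => by
      have e := hg ht
      rw [show a + b - (a + b - t) = t by ring, add_comm, e,
        show a + b - 2 * (a + b - t) = -(a + b - 2 * t) by ring, abs_neg]
    have := (hboth (a + b - t) (by linarith [ht.2]) (by linarith) hg').2
    rwa [show a + b - (a + b - t) = t by ring] at this

end Gap

/-! ### The explicit minimizer -/

theorem orderStat_mono {n : ℕ} (X : Fin n → ℝ) {i j : ℕ} (hij : i ≤ j) (hj : j ≤ n) :
    orderStat X i ≤ orderStat X j := by
  induction j, hij using Nat.le_induction with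
  | base => exact le_rfl
  | succ k hk ih => exact (ih (by omega)).trans (sub_nonneg.1 (gap_nonneg X hj))

theorem orderStat_succ {n : ℕ} (X : Fin n → ℝ) (j : Fin n) :
    orderStat X (j + 1) = X (Tuple.sort X j) := by
  simp [orderStat]

theorem orderStat_mem_range {n : ℕ} (X : Fin n → ℝ) {i : ℕ} (h1 : 1 ≤ i) (hi : i ≤ n) :
    orderStat X i ∈ range X := by
  have h : i - 1 < n := by omega
  rw [orderStat, dif_pos h]
  exact mem_range_self _

/-- The map that climbs from `0` to `g` at slope `K`, in a window centred at `c`. -/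
noncomputable def ramp (K g c u : ℝ) : ℝ :=
  max 0 (min g (K * (u - c) + g / 2))

theorem ramp_mono {K : ℝ} (hK : 0 < K) (g c : ℝ) : Monotone (ramp K g c) := by
  intro u v huv
  have : K * (u - c) ≤ K * (v - c) := mul_le_mul_of_nonneg_left (by linarith) hK.le
  exact max_le_max le_rfl (min_le_min le_rfl (by linarith))

theorem ramp_sub_le {K : ℝ} (hK : 0 < K) (g c : ℝ) {u v : ℝ} (huv : u ≤ v) :
    ramp K g c v - ramp K g c u ≤ K * (v - u) := by
  have : 0 ≤ K * (v - u) := mul_nonneg hK.le (by linarith)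
  have e : K * (v - c) + g / 2 = K * (u - c) + g / 2 + K * (v - u) := by ring
  unfold ramp
  rw [e]
  rcases max_choice 0 (min g (K * (u - c) + g / 2 + K * (v - u))) with h | h <;>
  rcases min_choice g (K * (u - c) + g / 2) with h' | h' <;>
  linarith [le_max_left 0 (min g (K * (u - c) + g / 2)),
    le_max_right 0 (min g (K * (u - c) + g / 2)),
    min_le_left g (K * (u - c) + g / 2 + K * (v - u)),
    min_le_right g (K * (u - c) + g / 2 + K * (v - u))]

section

variable {n : ℕ} (X : Fin n → ℝ) {K : ℝ} (hK : 0 < K)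
  (hgap : ∀ i, 1 ≤ i → i ≤ n - 1 → n * gap X i ≤ K)

include hK

theorem mul_sub_left (i : ℕ) (u : ℝ) :
    K * (u - left X K i) = K * (u - i / n) + gap X i / 2 := by
  unfold left
  field_simp
  ring

theorem pieces_mem_range {m : ℕ} (hm : m + 1 ≤ n) {u : ℝ}
    (hu : ∀ i < m, u ∉ Ioo (left X K (i + 1)) (right X K (i + 1))) :
    pieces X K m u ∈ range X := by
  induction m with
  | zero => exact orderStat_mem_range X le_rfl hm
  | succ m ih =>
    rw [pieces]
    split_ifs with h h'
    · exact ih (by omega) fun i hi => hu i (by omega)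
    · have e : u = right X K (m + 1) := by
        by_contra hne
        exact hu m (by omega) ⟨not_le.1 h, lt_of_le_of_ne h' hne⟩
      have hright : K * (right X K (m + 1) - left X K (m + 1)) = gap X (m + 1) := by
        unfold left right
        field_simp
        ring
      rw [e, hright, gap, add_sub_cancel]
      exact orderStat_mem_range X (by omega) (by omega)
    · exact orderStat_mem_range X (by omega) (by omega)

include hgap

theorem pieces_succ {m : ℕ} (hm : m + 2 ≤ n) (u : ℝ) :
    pieces X K (m + 1) u
      = pieces X K m u + ramp K (gap X (m + 1)) ((m + 1 : ℕ) / n) u := by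
  have hg := gap_nonneg X (i := m + 1) hm
  have hright : K * (right X K (m + 1) - left X K (m + 1)) = gap X (m + 1) := by
    unfold left right
    field_simp
    ring
  rw [pieces, ramp, ← mul_sub_left X hK]
  by_cases h : u ≤ left X K (m + 1)
  · have h0 : K * (u - left X K (m + 1)) ≤ 0 := mul_nonpos_of_nonneg_of_nonpos hK.le (by linarith)
    rw [if_pos h, max_eq_left ((min_le_right _ _).trans h0), add_zero]
  have h0 : 0 ≤ K * (u - left X K (m + 1)) := mul_nonneg hK.le (by linarith)
  have hflat : pieces X K m u = orderStat X (m + 1) :=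
    pieces_flat X hK hgap (by omega) fun h1 =>
      (right_le_left X hK hgap h1 hm).trans (not_le.1 h).le
  rw [if_neg h, hflat, max_eq_right (le_min hg h0)]
  by_cases h' : u ≤ right X K (m + 1)
  · rw [if_pos h', min_eq_right]
    rw [← hright]
    exact mul_le_mul_of_nonneg_left (by linarith) hK.le
  · rw [if_neg h', min_eq_left, gap]
    · show orderStat X (m + 2) = orderStat X (m + 1) + (orderStat X (m + 2) - orderStat X (m + 1))
      ring
    · rw [← hright]
      exact mul_le_mul_of_nonneg_left (by linarith) hK.le

theorem pieces_eq_sum {m : ℕ} (hm : m + 1 ≤ n) (u : ℝ) :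
    pieces X K m u
      = orderStat X 1 + ∑ i ∈ Finset.range m, ramp K (gap X (i + 1)) ((i + 1 : ℕ) / n) u := by
  induction m with
  | zero => simp [pieces]
  | succ m ih =>
    rw [pieces_succ X hK hgap hm, ih (by omega), Finset.sum_range_succ, add_assoc]

theorem pieces_mono {m : ℕ} (hm : m + 1 ≤ n) : Monotone (pieces X K m) := by
  intro u v huv
  rw [pieces_eq_sum X hK hgap hm, pieces_eq_sum X hK hgap hm]
  gcongr
  exact ramp_mono hK _ _ huv

/-- The windows of the increasing pieces do not overlap, so that their slopes do not add up. -/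
theorem pieces_sub_le {m : ℕ} (hm : m + 1 ≤ n) {u v : ℝ} (huv : u ≤ v) :
    pieces X K m v - pieces X K m u ≤ K * (v - u) := by
  induction m generalizing u v with
  | zero =>
    simp only [pieces, sub_self]
    exact mul_nonneg hK.le (by linarith)
  | succ m ih =>
    have before : ∀ {x}, x ≤ left X K (m + 1) → pieces X K (m + 1) x = pieces X K m x := by
      intro x hx
      rw [pieces, if_pos hx]
    have after : ∀ {x y}, left X K (m + 1) ≤ x → x ≤ y →
        pieces X K (m + 1) y - pieces X K (m + 1) x ≤ K * (y - x) := by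
      intro x y hx hxy
      have flat : ∀ z, left X K (m + 1) ≤ z → pieces X K m z = orderStat X (m + 1) :=
        fun z hz => pieces_flat X hK hgap (by omega) fun h1 =>
          (right_le_left X hK hgap h1 hm).trans hz
      rw [pieces_succ X hK hgap hm, pieces_succ X hK hgap hm, flat x hx, flat y (hx.trans hxy)]
      linarith [ramp_sub_le hK (gap X (m + 1)) ((m + 1 : ℕ) / n) hxy]
    rcases le_total v (left X K (m + 1)) with hv | hv
    · rw [before hv, before (huv.trans hv)]
      exact ih (by omega) huv
    rcases le_total u (left X K (m + 1)) with hu | hu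
    · have h1 := ih (by omega) hu
      rw [← before hu, ← before le_rfl] at h1
      linarith [after le_rfl hv]
    · exact after hu huv

variable (hn : 1 ≤ n)

include hn

theorem Gstar_mono : Monotone (Gstar X K) := fun _ _ huv =>
  pieces_mono X hK hgap (by omega) huv

theorem Gstar_mem_lip : Gstar X K ∈ lip I ℝ K := by
  have aux : ∀ x y : I, x ≤ y → dist (Gstar X K x) (Gstar X K y) ≤ K * dist x y := by
    intro x y hxy
    have h1 := Gstar_mono X hK hgap hn hxy
    have h2 := pieces_sub_le X hK hgap (m := n - 1) (by omega) (u := x) (v := y) hxy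
    have hxy' : (x : ℝ) ≤ y := hxy
    rw [dist_comm, dist_comm x y, Subtype.dist_eq, Real.dist_eq, Real.dist_eq,
      abs_of_nonneg (sub_nonneg.2 h1), abs_of_nonneg (sub_nonneg.2 hxy')]
    exact h2
  intro x y
  rcases le_total x y with h | h
  · exact aux x y h
  · rw [dist_comm, dist_comm x y]
    exact aux y x h

theorem gap_div_le {i : ℕ} (h1 : 1 ≤ i) (hi : i + 1 ≤ n) : gap X i / K ≤ 1 / n := by
  have hn0 : (0 : ℝ) < n := by exact_mod_cast hn
  rw [div_le_div_iff₀ hK hn0]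
  linarith [hgap i h1 (by omega)]

theorem Gstar_zero : Gstar X K 0 = orderStat X 1 := by
  rcases hn.eq_or_lt with h | h
  · subst h
    rfl
  · refine Gstar_first X hK hgap h 0 ?_
    have e : left X K 1 = 1 / n - gap X 1 / K / 2 := by
      unfold left
      push_cast
      field_simp
    have hn0 : (0 : ℝ) < 1 / n := one_div_pos.2 (by exact_mod_cast hn)
    have := gap_div_le X hK hgap hn le_rfl h
    rw [e]
    rw [Icc.coe_zero]
    linarith

theorem Gstar_one : Gstar X K 1 = orderStat X n := by
  rcases hn.eq_or_lt with h | h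
  · subst h
    rfl
  · refine Gstar_last X hK hgap hn 1 ?_
    have hn1 : (0 : ℝ) < n := by exact_mod_cast hn
    have e : right X K (n - 1) = 1 - 1 / n + gap X (n - 1) / K / 2 := by
      unfold right
      rw [Nat.cast_sub hn]
      push_cast
      field_simp
    have hn0 : (0 : ℝ) < 1 / n := one_div_pos.2 hn1
    have := gap_div_le X hK hgap hn (i := n - 1) (by omega) (by omega)
    rw [e]
    rw [Icc.coe_one]
    linarith

/-- The time that `Ĝ*_K` spends away from the sample is the total length of its increasing
pieces. -/
theorem volume_Gstar_notMem_range_le :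
    K * volume.real {u | Gstar X K u ∉ range X} ≤ Gstar X K 1 - Gstar X K 0 := by
  have hsub : {u | Gstar X K u ∉ range X} ⊆ ⋃ i ∈ Finset.range (n - 1),
      {u : I | (u : ℝ) ∈ Ioo (left X K (i + 1)) (right X K (i + 1))} := by
    intro u hu
    by_contra hcon
    simp only [mem_iUnion, Finset.mem_range, not_exists] at hcon
    exact hu (pieces_mem_range X hK (by omega) fun i hi => hcon i hi)
  have hone : ∀ i ∈ Finset.range (n - 1),
      volume.real {u : I | (u : ℝ) ∈ Ioo (left X K (i + 1)) (right X K (i + 1))}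
        ≤ gap X (i + 1) / K := by
    intro i hi
    have hi' := Finset.mem_range.1 hi
    have hlr := left_le_right X hK (i := i + 1) (by omega)
    have e : right X K (i + 1) - left X K (i + 1) = gap X (i + 1) / K := by
      unfold left right
      field_simp
      ring
    rw [← e, ← Real.volume_real_Ioo_of_le hlr, measureReal_def, unitInterval.volume_apply]
    refine ENNReal.toReal_mono (by simp) (measure_mono ?_)
    rintro _ ⟨u, hu, rfl⟩
    exact hu
  have hle := (measureReal_mono hsub (measure_ne_top _ _)).trans
    ((measureReal_biUnion_finset_le _ _).trans (Finset.sum_le_sum hone))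
  rw [← Finset.sum_div, le_div_iff₀ hK] at hle
  unfold gap at hle
  rw [Finset.sum_range_sub (fun i => orderStat X (i + 1)), Nat.sub_add_cancel hn] at hle
  rw [Gstar_one X hK hgap hn, Gstar_zero X hK hgap hn]
  linarith

end

/-! ### The quantile coupling -/

/-- The (zero-based) index of the cell `[i / n, (i + 1) / n)` that contains `u`; the point `1` is
put into the last cell. -/
noncomputable def cellIndex {n : ℕ} (hn : 1 ≤ n) (u : I) : Fin n :=
  ⟨min ⌊(n : ℝ) * u⌋₊ (n - 1), by omega⟩

theorem measurable_cellIndex {n : ℕ} (hn : 1 ≤ n) : Measurable (cellIndex hn) := by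
  have h : Measurable fun u : I => ⌊(n : ℝ) * u⌋₊ := Nat.measurable_floor.comp (by fun_prop)
  exact (measurable_from_nat (f := fun k => (⟨min k (n - 1), by omega⟩ : Fin n))).comp h

theorem map_cellIndex {n : ℕ} (hn : 1 ≤ n) :
    (volume : Measure I).map (cellIndex hn) = (n : ℝ≥0∞)⁻¹ • ∑ i, Measure.dirac i := by
  have hn0 : (0 : ℝ) < n := by exact_mod_cast hn
  refine Measure.ext_of_singleton fun i => ?_
  have hi : (i : ℝ) + 1 ≤ n := by exact_mod_cast i.2
  have hvol : ENNReal.ofReal (((i : ℝ) + 1) / n - i / n) = (n : ℝ≥0∞)⁻¹ := by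
    rw [← sub_div, add_sub_cancel_left, one_div, ENNReal.ofReal_inv_of_pos hn0,
      ENNReal.ofReal_natCast]
  rw [Measure.map_apply (measurable_cellIndex hn) (measurableSet_singleton i),
    unitInterval.volume_apply]
  have hR : ((n : ℝ≥0∞)⁻¹ • ∑ i, Measure.dirac i) {i} = (n : ℝ≥0∞)⁻¹ := by
    simp [Measure.smul_apply, Measure.finsetSum_apply, Set.indicator_apply]
  rw [hR, ← hvol]
  apply le_antisymm
  · rw [← Real.volume_Icc]
    refine measure_mono ?_
    rintro _ ⟨u, hu, rfl⟩
    have hu' : min ⌊(n : ℝ) * u⌋₊ (n - 1) = i := congrArg Fin.val hu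
    have hfl : (⌊(n : ℝ) * u⌋₊ : ℝ) ≤ n * u := Nat.floor_le (mul_nonneg hn0.le u.2.1)
    have hlt := Nat.lt_floor_add_one ((n : ℝ) * u)
    have hi1 : (i : ℕ) ≤ ⌊(n : ℝ) * u⌋₊ := hu' ▸ min_le_left _ _
    have hi1' : (i : ℝ) ≤ ⌊(n : ℝ) * u⌋₊ := by exact_mod_cast hi1
    constructor
    · rw [div_le_iff₀ hn0]
      linarith
    · rw [le_div_iff₀ hn0]
      rcases hi1.eq_or_lt with h | h
      · rw [← h] at hlt
        linarith
      · have : (n : ℝ) ≤ i + 1 := by exact_mod_cast (by omega : n ≤ i + 1)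
        have := mul_le_mul_of_nonneg_left u.2.2 hn0.le
        linarith
  · rw [← Real.volume_Ioo]
    refine measure_mono fun x hx => ?_
    have h1 := (div_lt_iff₀ hn0).1 hx.1
    have h2 := (lt_div_iff₀ hn0).1 hx.2
    have hx0 : 0 ≤ x := (div_nonneg (Nat.cast_nonneg _) hn0.le).trans hx.1.le
    have hx1 : x ≤ 1 := hx.2.le.trans ((div_le_one hn0).2 hi)
    refine ⟨⟨x, hx0, hx1⟩, Fin.ext ?_, rfl⟩
    have hfl : ⌊(n : ℝ) * x⌋₊ = i := (Nat.floor_eq_iff (mul_nonneg hn0.le hx0)).2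
      ⟨by linarith, by linarith⟩
    show min ⌊(n : ℝ) * x⌋₊ (n - 1) = i
    rw [hfl]
    have := i.2
    omega

theorem empirical_comp_perm {n : ℕ} (X : Fin n → ℝ) (e : Equiv.Perm (Fin n)) :
    empirical (X ∘ e) = empirical X := by
  unfold empirical
  rw [← Equiv.sum_comp e fun i => Measure.dirac (X i)]
  rfl

/-- The quantile function of the empirical measure. -/
noncomputable def quantile {n : ℕ} (hn : 1 ≤ n) (X : Fin n → ℝ) (u : I) : ℝ :=
  orderStat X (cellIndex hn u + 1)

theorem measurable_quantile {n : ℕ} (hn : 1 ≤ n) (X : Fin n → ℝ) : Measurable (quantile hn X) :=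
  (measurable_of_finite fun i : Fin n => orderStat X (i + 1)).comp (measurable_cellIndex hn)

theorem law_quantile {n : ℕ} (hn : 1 ≤ n) (X : Fin n → ℝ) :
    law (quantile hn X) = empirical X := by
  have e : quantile hn X = (X ∘ Tuple.sort X) ∘ cellIndex hn :=
    funext fun u => orderStat_succ X _
  have hm : Measurable (X ∘ Tuple.sort X) := measurable_of_finite _
  rw [law, e, ← Measure.map_map hm (measurable_cellIndex hn), map_cellIndex,
    Measure.map_smul, ← empirical_comp_perm X (Tuple.sort X), empirical,
    Measure.map_finset_sum hm.aemeasurable]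
  simp only [Measure.map_dirac' hm]

theorem quantile_eq_sum {n : ℕ} (hn : 1 ≤ n) (X : Fin n → ℝ) (u : I) :
    quantile hn X u = orderStat X 1 + ∑ i ∈ Finset.range (n - 1),
      if ((i + 1 : ℕ) / n : ℝ) ≤ u then gap X (i + 1) else 0 := by
  have hn0 : (0 : ℝ) < n := by exact_mod_cast hn
  rw [← Finset.sum_filter]
  have hf : (Finset.range (n - 1)).filter (fun i => ((i + 1 : ℕ) / n : ℝ) ≤ u)
      = Finset.range (cellIndex hn u) := by
    ext i
    have : ((i + 1 : ℕ) / n : ℝ) ≤ u ↔ i + 1 ≤ ⌊(n : ℝ) * u⌋₊ := by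
      rw [Nat.le_floor_iff (mul_nonneg hn0.le u.2.1), div_le_iff₀ hn0, mul_comm (u : ℝ)]
    rw [Finset.mem_filter, Finset.mem_range, Finset.mem_range, this]
    simp only [cellIndex]
    omega
  rw [hf]
  unfold gap
  rw [Finset.sum_range_sub (fun i => orderStat X (i + 1)), quantile]
  ring

/-- The difference between a ramp and the jump that it smooths. -/
noncomputable def tent (K g c u : ℝ) : ℝ :=
  max 0 (g / 2 - K * |u - c|)

theorem abs_ramp_sub_le_tent {K g : ℝ} (hK : 0 < K) (hg : 0 ≤ g) (c u : ℝ) :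
    |ramp K g c u - if c ≤ u then g else 0| ≤ tent K g c u := by
  unfold ramp tent
  split_ifs with h
  · have h0 : 0 ≤ K * (u - c) := mul_nonneg hK.le (by linarith)
    rw [abs_of_nonneg (sub_nonneg.2 h), max_eq_right (le_min hg (by linarith)), abs_sub_comm,
      abs_of_nonneg (sub_nonneg.2 (min_le_left _ _))]
    rcases min_choice g (K * (u - c) + g / 2) with e | e <;> rw [e]
    · simp
    · exact le_max_of_le_right (by linarith)
  · have h0 : K * (u - c) ≤ 0 := mul_nonpos_of_nonneg_of_nonpos hK.le (by linarith)
    rw [abs_of_neg (sub_neg.2 (not_le.1 h)), sub_zero, min_eq_right (by linarith),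
      abs_of_nonneg (le_max_left _ _)]
    exact max_le_max le_rfl (by linarith)

theorem lintegral_tent_le {K g : ℝ} (hK : 0 < K) (hg : 0 ≤ g) (c : ℝ) :
    ∫⁻ u : I, ENNReal.ofReal (tent K g c u) ≤ ENNReal.ofReal (g ^ 2 / (4 * K)) := by
  have hm : Measurable fun x : ℝ => ENNReal.ofReal (tent K g c x) := by
    unfold tent
    fun_prop
  rw [unitInterval.measurePreserving_coe.lintegral_comp hm]
  refine (setLIntegral_le_lintegral _ _).trans ?_
  set a := c - g / (2 * K) with ha
  set b := c + g / (2 * K) with hb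
  have hd : 0 ≤ g / (2 * K) := by positivity
  have hab : a ≤ b := by linarith
  have hsum : ∀ x, K * |x - c| = K / 2 * |a + b - 2 * x| := by
    intro x
    rw [show a + b - 2 * x = 2 * (c - x) by rw [ha, hb]; ring, abs_mul, abs_two, abs_sub_comm]
    ring
  have hz : ∀ x, x ∉ Ioo a b → ENNReal.ofReal (tent K g c x) = 0 := by
    intro x hx
    rw [ENNReal.ofReal_eq_zero, tent, max_eq_left]
    have : g / (2 * K) ≤ |x - c| := by
      by_contra! hlt
      obtain ⟨h1, h2⟩ := abs_lt.1 hlt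
      exact hx ⟨by linarith, by linarith⟩
    have := mul_le_mul_of_nonneg_left this hK.le
    have e : K * (g / (2 * K)) = g / 2 := by field_simp
    linarith
  have hin : ∀ x ∈ Ioo a b, 0 ≤ g / 2 - K / 2 * |a + b - 2 * x| := by
    intro x hx
    have : |x - c| ≤ g / (2 * K) := abs_le.2 ⟨by linarith [hx.1], by linarith [hx.2]⟩
    have := mul_le_mul_of_nonneg_left this hK.le
    have e : K * (g / (2 * K)) = g / 2 := by field_simp
    rw [← hsum]
    linarith
  rw [← setLIntegral_eq_of_support_subset (s := Ioo a b)
    (fun x hx => by_contra fun h => hx (hz x h))]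
  have e : ∫⁻ x in Ioo a b, ENNReal.ofReal (tent K g c x)
      = ∫⁻ x in Ioo a b, ENNReal.ofReal (g / 2 - K / 2 * |a + b - 2 * x|) :=
    setLIntegral_congr_fun measurableSet_Ioo fun x hx => by
      rw [tent, hsum, max_eq_right (hin x hx)]
  rw [e, lintegral_Ioo_eq_ofReal_integral (by fun_prop) hab hin,
    intervalIntegral.integral_sub (by simp) (Continuous.intervalIntegrable (by fun_prop) _ _),
    intervalIntegral.integral_const_mul, integral_abs_sub_midpoint hab,
    intervalIntegral.integral_const, smul_eq_mul]
  refine ENNReal.ofReal_le_ofReal (le_of_eq ?_)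
  rw [ha, hb]
  field_simp
  ring

/-- The cost of the coupling of `Ĝ*_K(U)` with the quantile function at `U` splits into one tent
for each gap. -/
theorem W1_law_Gstar_le {n : ℕ} (hn : 1 ≤ n) (X : Fin n → ℝ) {K : ℝ} (hK : 0 < K)
    (hgap : ∀ i, 1 ≤ i → i ≤ n - 1 → n * gap X i ≤ K) :
    W1 (law (Gstar X K)) (empirical X)
      ≤ ∑ i ∈ Finset.range (n - 1), ENNReal.ofReal (gap X (i + 1) ^ 2 / (4 * K)) := by
  have mG := (lip.continuous hK (Gstar_mem_lip X hK hgap hn)).measurable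
  have mQ := measurable_quantile hn X
  have mem : (volume : Measure I).map (fun u => (Gstar X K u, quantile hn X u))
      ∈ couplings (law (Gstar X K)) (empirical X) := by
    constructor
    · rw [Measure.map_map measurable_fst (mG.prodMk mQ)]
      rfl
    · rw [Measure.map_map measurable_snd (mG.prodMk mQ), ← law_quantile hn X]
      rfl
  refine (iInf₂_le _ mem).trans ?_
  rw [lintegral_map measurable_edist (mG.prodMk mQ)]
  calc ∫⁻ u, edist (Gstar X K u) (quantile hn X u)
      ≤ ∫⁻ u : I, ∑ i ∈ Finset.range (n - 1),
          ENNReal.ofReal (tent K (gap X (i + 1)) ((i + 1 : ℕ) / n) u) := by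
        refine lintegral_mono fun u => ?_
        have hnn : ∀ i ∈ Finset.range (n - 1),
            0 ≤ tent K (gap X (i + 1)) ((i + 1 : ℕ) / n) u := fun i _ => le_max_left _ _
        rw [← ENNReal.ofReal_sum_of_nonneg hnn, edist_dist, Real.dist_eq, Gstar,
          pieces_eq_sum X hK hgap (by omega), quantile_eq_sum, add_sub_add_left_eq_sub,
          ← Finset.sum_sub_distrib]
        refine ENNReal.ofReal_le_ofReal ((Finset.abs_sum_le_sum_abs _ _).trans
          (Finset.sum_le_sum fun i hi => ?_))
        have hi' := Finset.mem_range.1 hi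
        exact abs_ramp_sub_le_tent hK (gap_nonneg X (by omega)) _ _
    _ = ∑ i ∈ Finset.range (n - 1),
          ∫⁻ u : I, ENNReal.ofReal (tent K (gap X (i + 1)) ((i + 1 : ℕ) / n) u) := by
        refine lintegral_finsetSum _ fun i _ => ?_
        unfold tent
        fun_prop
    _ ≤ _ := Finset.sum_le_sum fun i hi => lintegral_tent_le hK
        (gap_nonneg X (by have := Finset.mem_range.1 hi; omega)) _

/-! ### The lower bound and the case of equality -/

theorem isProbabilityMeasure_empirical {n : ℕ} (hn : 1 ≤ n) (X : Fin n → ℝ) :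
    IsProbabilityMeasure (empirical X) := by
  rw [← law_quantile hn X]
  exact isProbabilityMeasure_law (measurable_quantile hn X)

/-- The `i`-th component of the complement of the sample, `0 ≤ i ≤ n`: the interval
`(X_(i), X_(i+1))`, which is unbounded to the left for `i = 0` and to the right for `i = n`. -/
def spacing {n : ℕ} (X : Fin n → ℝ) (i : ℕ) : Set ℝ :=
  {t | (1 ≤ i → orderStat X i < t) ∧ (i < n → t < orderStat X (i + 1))}

theorem spacing_eq_Ioo {n : ℕ} (X : Fin n → ℝ) {i : ℕ} (h1 : 1 ≤ i) (hi : i < n) :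
    spacing X i = Ioo (orderStat X i) (orderStat X (i + 1)) := by
  ext t
  simp [spacing, h1, hi]

theorem measurableSet_spacing {n : ℕ} (X : Fin n → ℝ) (i : ℕ) : MeasurableSet (spacing X i) := by
  have h1 : MeasurableSet {t | 1 ≤ i → orderStat X i < t} := by
    by_cases h : 1 ≤ i
    · simp only [h, true_imp_iff]
      exact measurableSet_Ioi
    · simp [h]
  have h2 : MeasurableSet {t | i < n → t < orderStat X (i + 1)} := by
    by_cases h : i < n
    · simp only [h, true_imp_iff]
      exact measurableSet_Iio
    · simp [h]
  exact h1.inter h2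

theorem pairwiseDisjoint_spacing {n : ℕ} (X : Fin n → ℝ) :
    (Finset.range (n + 1) : Set ℕ).PairwiseDisjoint (spacing X) := by
  have aux : ∀ i j, j ≤ n → i < j → Disjoint (spacing X i) (spacing X j) := by
    intro i j hj hij
    refine disjoint_left.2 fun t ht ht' => ?_
    have h1 := ht.2 (by omega)
    have h2 := ht'.1 (by omega)
    have h3 := orderStat_mono X (i := i + 1) hij hj
    linarith
  intro i hi j hj hne
  simp only [Finset.coe_range, mem_Iio] at hi hj
  rcases lt_or_gt_of_ne hne with h | h
  · exact aux i j (by omega) h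
  · exact (aux j i (by omega) h).symm

theorem exists_mem_spacing {n : ℕ} (X : Fin n → ℝ) {t : ℝ} (ht : t ∉ range X) :
    ∃ i ≤ n, t ∈ spacing X i := by
  classical
  refine ⟨Nat.findGreatest (fun k => k = 0 ∨ orderStat X k < t) n, Nat.findGreatest_le n, ?_, ?_⟩
  · intro h1
    have := Nat.findGreatest_spec (P := fun k => k = 0 ∨ orderStat X k < t) (Nat.zero_le n)
      (Or.inl rfl)
    exact this.resolve_left (by omega)
  · intro h2
    have := Nat.findGreatest_is_greatest (P := fun k => k = 0 ∨ orderStat X k < t)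
      (Nat.lt_succ_self _) h2
    push Not at this
    refine lt_of_le_of_ne this.2 fun h => ht (h ▸ orderStat_mem_range X (by omega) h2)

theorem cdf_empirical {n : ℕ} (hn : 1 ≤ n) (X : Fin n → ℝ) {i : ℕ} (hi : i ≤ n) {t : ℝ}
    (ht : t ∈ spacing X i) : cdf (empirical X) t = (i : ℝ) / n := by
  have := isProbabilityMeasure_empirical hn X
  have key : ∀ j : Fin n, (X ∘ Tuple.sort X) j ≤ t ↔ (j : ℕ) < i := by
    intro j
    have hj := j.2
    rw [Function.comp_apply, ← orderStat_succ X j]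
    constructor
    · intro h
      by_contra! hij
      have h1 := ht.2 (by omega)
      have h2 := orderStat_mono X (i := i + 1) (j := j + 1) (by omega) (by omega)
      linarith
    · intro h
      have h1 := ht.1 (by omega)
      have h2 := orderStat_mono X (i := j + 1) (j := i) (by omega) hi
      linarith
  rw [cdf_eq_real, measureReal_def, ← empirical_comp_perm X (Tuple.sort X), empirical,
    Measure.smul_apply, Measure.finsetSum_apply]
  have e : ∀ j : Fin n, Measure.dirac ((X ∘ Tuple.sort X) j) (Iic t)
      = if (j : ℕ) < i then (1 : ℝ≥0∞) else 0 := by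
    intro j
    rw [Measure.dirac_apply' _ measurableSet_Iic, indicator_apply]
    simp only [mem_Iic, key j, Pi.one_apply]
  simp_rw [e]
  rw [Finset.sum_boole, Fin.card_filter_val_lt, min_eq_right hi]
  simp [div_eq_inv_mul]

/-- The least cost of crossing the `i`-th component of the complement of the sample. -/
noncomputable def spacingCost {n : ℕ} (X : Fin n → ℝ) (K : ℝ) (i : ℕ) : ℝ≥0∞ :=
  if 1 ≤ i ∧ i < n then ENNReal.ofReal (gap X i ^ 2 / (4 * K)) else 0

/-- The distribution function of every minimizer on the `i`-th component of the complement of the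
sample. -/
noncomputable def optimalCdf {n : ℕ} (X : Fin n → ℝ) (K : ℝ) (i : ℕ) (t : ℝ) : ℝ :=
  if 1 ≤ i ∧ i < n then (i : ℝ) / n + (t - (orderStat X i + orderStat X (i + 1)) / 2) / K
  else (i : ℝ) / n

theorem sum_spacingCost {n : ℕ} (X : Fin n → ℝ) {K : ℝ} (hK : 0 < K) :
    ∑ i ∈ Finset.range (n + 1), spacingCost X K i
      = ENNReal.ofReal (1 / (4 * K) * ∑ i ∈ Finset.Icc 1 (n - 1), gap X i ^ 2) := by
  have hf : (Finset.range (n + 1)).filter (fun i => 1 ≤ i ∧ i < n) = Finset.Icc 1 (n - 1) := by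
    ext i
    simp only [Finset.mem_filter, Finset.mem_range, Finset.mem_Icc]
    omega
  unfold spacingCost
  rw [← Finset.sum_filter, hf, ← ENNReal.ofReal_sum_of_nonneg fun i _ => by positivity,
    Finset.mul_sum]
  congr 1
  exact Finset.sum_congr rfl fun i _ => by ring

theorem sum_range_gap_cost {n : ℕ} (X : Fin n → ℝ) {K : ℝ} (hK : 0 < K) :
    ∑ i ∈ Finset.range (n - 1), ENNReal.ofReal (gap X (i + 1) ^ 2 / (4 * K))
      = ENNReal.ofReal (1 / (4 * K) * ∑ i ∈ Finset.Icc 1 (n - 1), gap X i ^ 2) := by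
  have e : Finset.Icc 1 (n - 1) = (Finset.range (n - 1)).map (addRightEmbedding 1) := by
    ext i
    simp only [Finset.mem_Icc, Finset.mem_map, Finset.mem_range, addRightEmbedding_apply]
    constructor
    · intro h
      exact ⟨i - 1, by omega, by omega⟩
    · rintro ⟨k, hk, rfl⟩
      omega
  rw [e, Finset.sum_map, ← ENNReal.ofReal_sum_of_nonneg fun i _ => by positivity, Finset.mul_sum]
  congr 1
  exact Finset.sum_congr rfl fun i _ => by
    rw [addRightEmbedding_apply]
    ring

theorem _root_.ENNReal.le_of_sum_le_sum {ι : Type*} {s : Finset ι} {a b : ι → ℝ≥0∞}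
    (hab : ∀ i ∈ s, a i ≤ b i) (h : ∑ i ∈ s, b i ≤ ∑ i ∈ s, a i) (hfin : ∑ i ∈ s, a i ≠ ∞) {i : ι}
    (hi : i ∈ s) : b i ≤ a i := by
  classical
  by_contra! hlt
  rw [← Finset.add_sum_erase s a hi] at h hfin
  rw [← Finset.add_sum_erase s b hi] at h
  exact not_lt.2 h (ENNReal.add_lt_add_of_lt_of_le (ENNReal.add_ne_top.1 hfin).2 hlt
    (Finset.sum_le_sum fun j hj => hab j (Finset.mem_of_mem_erase hj)))

/-- The levels `i / n` and `1 - i / n` are at least `gap / K`, so that a distribution function that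
is still `0`, or already `1`, in a gap costs more than one that crosses it. -/
theorem gap_div_le_div {n : ℕ} (hn : 1 ≤ n) (X : Fin n → ℝ) {K : ℝ} (hK : 0 < K)
    (hgap : ∀ i, 1 ≤ i → i ≤ n - 1 → n * gap X i ≤ K) {i : ℕ} (h1 : 1 ≤ i) (hi : i < n) :
    gap X i / K ≤ (i : ℝ) / n ∧ gap X i / K ≤ 1 - (i : ℝ) / n := by
  have hn0 : (0 : ℝ) < n := by exact_mod_cast hn
  have h := gap_div_le X hK hgap hn h1 hi
  have h1' : (1 : ℝ) ≤ i := by exact_mod_cast h1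
  have hi' : (i : ℝ) + 1 ≤ n := by exact_mod_cast hi
  refine ⟨h.trans (div_le_div_of_nonneg_right h1' hn0.le), h.trans ?_⟩
  rw [← sub_nonneg, show 1 - (i : ℝ) / n - 1 / n = (n - (i + 1)) / n by field_simp; ring]
  exact div_nonneg (by linarith) hn0.le

section

variable {n : ℕ} (hn : 1 ≤ n) (X : Fin n → ℝ) {K : ℝ} (hK : 0 < K)
  (hgap : ∀ i, 1 ≤ i → i ≤ n - 1 → n * gap X i ≤ K) {G : I → ℝ} (hG : G ∈ lip I ℝ K)

include hn hK hgap hG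

theorem spacingCost_le (i : ℕ) :
    spacingCost X K i ≤ ∫⁻ t in spacing X i, ENNReal.ofReal |cdf (law G) t - (i : ℝ) / n| := by
  unfold spacingCost
  split_ifs with h
  swap
  · exact zero_le
  obtain ⟨h1, hi⟩ := h
  obtain ⟨hp, hp'⟩ := gap_div_le_div hn X hK hgap h1 hi
  rw [spacing_eq_Ioo X h1 hi]
  exact le_lintegral_gap hK (orderStat_mono X (by omega) hi)
    ((monotone_cdf _).measurable.sub_const _)
    (abs_add_abs_of_expansive (fun s t hst => cdf_law_expansive hK hG hst) hK hp hp')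

theorem ae_cdf_eq_optimalCdf_of_spacing {i : ℕ}
    (hint : ∫⁻ t in spacing X i, ENNReal.ofReal |cdf (law G) t - (i : ℝ) / n| ≤ spacingCost X K i) :
    ∀ᵐ t, t ∈ spacing X i → cdf (law G) t = optimalCdf X K i t := by
  have hm : Measurable (cdf (law G)) := (monotone_cdf _).measurable
  unfold spacingCost at hint
  unfold optimalCdf
  split_ifs at hint ⊢ with h
  · obtain ⟨h1, hi⟩ := h
    obtain ⟨hp, hp'⟩ := gap_div_le_div hn X hK hgap h1 hi
    rw [spacing_eq_Ioo X h1 hi] at hint ⊢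
    exact ae_eq_affine_of_lintegral_gap_le hm (fun s t hst => cdf_law_expansive hK hG hst) hK
      (orderStat_mono X (by omega) hi) hp hp' hint
  · have h0 := (lintegral_eq_zero_iff (by fun_prop)).1 (le_antisymm hint zero_le)
    rw [Filter.EventuallyEq, ae_restrict_iff' (measurableSet_spacing X i)] at h0
    filter_upwards [h0] with t ht hti
    have := abs_nonpos_iff.1 (ENNReal.ofReal_eq_zero.1 (ht hti))
    linarith

omit hK hgap hG in
theorem sum_lintegral_spacing_le_W1 (hG : Measurable G) :
    ∑ i ∈ Finset.range (n + 1),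
        ∫⁻ t in spacing X i, ENNReal.ofReal |cdf (law G) t - (i : ℝ) / n|
      ≤ W1 (law G) (empirical X) := by
  have := isProbabilityMeasure_law hG
  have := isProbabilityMeasure_empirical hn X
  refine le_trans (le_of_eq ?_) ((setLIntegral_le_lintegral
    (⋃ i ∈ Finset.range (n + 1), spacing X i) _).trans (lintegral_cdf_sub_le_W1 _ _))
  rw [lintegral_biUnion_finset (pairwiseDisjoint_spacing X)
    fun i _ => measurableSet_spacing X i]
  refine Finset.sum_congr rfl fun i hi => setLIntegral_congr_fun (measurableSet_spacing X i)
    fun t ht => ?_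
  have := Finset.mem_range.1 hi
  simp only [cdf_empirical hn X (i := i) (by omega) ht]

theorem sum_spacingCost_le_W1 :
    ∑ i ∈ Finset.range (n + 1), spacingCost X K i ≤ W1 (law G) (empirical X) :=
  (Finset.sum_le_sum fun i _ => spacingCost_le hn X hK hgap hG i).trans
    (sum_lintegral_spacing_le_W1 hn X (lip.continuous hK hG).measurable)

/-- Optimality forces equality on every component of the complement of the sample, and so
determines the distribution function almost everywhere. -/
theorem ae_cdf_eq_optimalCdf
    (hopt : W1 (law G) (empirical X) ≤ ∑ i ∈ Finset.range (n + 1), spacingCost X K i) :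
    ∀ᵐ t, ∀ i ≤ n, t ∈ spacing X i → cdf (law G) t = optimalCdf X K i t := by
  refine ae_all_iff.2 fun i => ?_
  by_cases hi : i ≤ n
  swap
  · exact .of_forall fun t h => absurd h hi
  refine (ae_cdf_eq_optimalCdf_of_spacing hn X hK hgap hG ?_).mono fun t ht _ => ht
  refine ENNReal.le_of_sum_le_sum (fun j _ => spacingCost_le hn X hK hgap hG j)
    ((sum_lintegral_spacing_le_W1 hn X (lip.continuous hK hG).measurable).trans hopt) ?_
    (Finset.mem_range.2 (Nat.lt_succ_of_le hi))
  rw [sum_spacingCost X hK]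
  exact ENNReal.ofReal_ne_top

end

theorem law_eq_of_optimal {n : ℕ} (hn : 1 ≤ n) (X : Fin n → ℝ) {K : ℝ} (hK : 0 < K)
    (hgap : ∀ i, 1 ≤ i → i ≤ n - 1 → n * gap X i ≤ K) {G H : I → ℝ} (hG : G ∈ lip I ℝ K)
    (hH : H ∈ lip I ℝ K)
    (hGopt : W1 (law G) (empirical X) ≤ ∑ i ∈ Finset.range (n + 1), spacingCost X K i)
    (hHopt : W1 (law H) (empirical X) ≤ ∑ i ∈ Finset.range (n + 1), spacingCost X K i) :
    law G = law H := by
  have := isProbabilityMeasure_law (lip.continuous hK hG).measurable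
  have := isProbabilityMeasure_law (lip.continuous hK hH).measurable
  refine eq_of_cdf_ae_eq ?_
  have hX : ∀ᵐ t, t ∉ range X := 
    measure_eq_zero_iff_ae_notMem.1 ((finite_range X).measure_zero volume)
  filter_upwards [ae_cdf_eq_optimalCdf hn X hK hgap hG hGopt,
    ae_cdf_eq_optimalCdf hn X hK hgap hH hHopt, hX] with t h1 h2 h3
  obtain ⟨i, hi, ht⟩ := exists_mem_spacing X h3
  rw [h1 i hi ht, h2 i hi ht]

end WGAN

/-- `unitInterval.symm` is the map `S(u) = 1 - u` of `[0,1]`. -/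
theorem mainTheorem1 (n : ℕ) (hn : 1 ≤ n) (X : Fin n → ℝ) (K : ℝ) (hK : 0 < K)
    (hgap : ∀ i : ℕ, 1 ≤ i → i ≤ n - 1 →
      n * (WGAN.orderStat X (i + 1) - WGAN.orderStat X i) ≤ K) :
    WGAN.Gstar X K ∈ WGAN.lip unitInterval ℝ K ∧
    WGAN.W1 (WGAN.law (WGAN.Gstar X K)) (WGAN.empirical X) = WGAN.optimalValue X K ∧
    WGAN.optimalValue X K =
      ENNReal.ofReal (1 / (4 * K) *
        ∑ i ∈ Finset.Icc 1 (n - 1), (WGAN.orderStat X (i + 1) - WGAN.orderStat X i) ^ 2) ∧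
    WGAN.minimizers X K = {WGAN.Gstar X K, WGAN.Gstar X K ∘ unitInterval.symm} := by
  have hmem := WGAN.Gstar_mem_lip X hK hgap hn
  have hupper : WGAN.W1 (WGAN.law (WGAN.Gstar X K)) (WGAN.empirical X)
      ≤ ∑ i ∈ Finset.range (n + 1), WGAN.spacingCost X K i := by
    rw [WGAN.sum_spacingCost X hK, ← WGAN.sum_range_gap_cost X hK]
    exact WGAN.W1_law_Gstar_le hn X hK hgap
  have hlower : ∑ i ∈ Finset.range (n + 1), WGAN.spacingCost X K i ≤ WGAN.optimalValue X K :=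
    le_iInf₂ fun G hG => WGAN.sum_spacingCost_le_W1 hn X hK hgap hG
  have hle : WGAN.optimalValue X K ≤ WGAN.W1 (WGAN.law (WGAN.Gstar X K)) (WGAN.empirical X) :=
    iInf₂_le _ hmem
  have hval : WGAN.optimalValue X K = ∑ i ∈ Finset.range (n + 1), WGAN.spacingCost X K i :=
    le_antisymm (hle.trans hupper) hlower
  have hopt : WGAN.W1 (WGAN.law (WGAN.Gstar X K)) (WGAN.empirical X) = WGAN.optimalValue X K :=
    le_antisymm (hupper.trans hlower) hle
  refine ⟨hmem, hopt, hval.trans (WGAN.sum_spacingCost X hK), Subset.antisymm ?_ ?_⟩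
  · rintro G ⟨hG, hGopt⟩
    exact WGAN.eq_or_eq_comp_symm_of_law_eq hK hG hmem (WGAN.Gstar_mono X hK hgap hn)
      (finite_range X) (WGAN.volume_Gstar_notMem_range_le X hK hgap hn)
      (WGAN.law_eq_of_optimal hn X hK hgap hG hmem (hGopt.trans hval).le hupper)
  · rintro G (rfl | rfl)
    · exact ⟨hmem, hopt⟩
    · refine ⟨WGAN.lip.comp_symm hmem, ?_⟩
      rw [WGAN.law_comp_symm (WGAN.lip.continuous hK hmem).measurable, hopt]
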